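/- Let $\mathbb{K}$ be a field and let $k\ge 0$ and $n\ge 2k+2$ be integers. Consider $[n]=\{1,\dots,n\}$ as the vertex set of a complete graph drawn with its vertices in order along a circle; its edges are the two-element subsets of $[n]$, and edges $\{i,j\}$ ($i<j$) and $\{i',j'\}$ ($i'<j'$) cross if $i<i'<j<j'$ or $i'<i<j'<j$. A set of $k+1$ mutually crossing edges is a $(k+1)$-crossing; a set of edges is $(k+1)$-free if it contains no $(k+1)$-crossing, and the inclusion-maximal $(k+1)$-free sets are the $k$-triangulations. Let $I_k(n)\subset\mathbb{K}[x_{i,j} : \{i,j\}\in\binom{[n]}{2}]$ be the ideal generated by all the Pfaffians of degree $k+1$ of the generic antisymmetric $n\times n$ matrix, that is, by the polynomials $\sum_{E}(-1)^{c(E)}\prod_{\{i,j\}\in E}x_{i,j}$, one for each $U\subseteq[n]$ with $|U|=2k+2$, where the sum runs over the perfect matchings $E$ of $U$ and $c(E)$ is the number of pairs of crossing edges in $E$. It defines the variety $\mathcal{P}f_k(n)$ of antisymmetric matrices (with zero diagonal) of rank at most $2k$. The algebraic matroid of $\mathcal{P}f_k(n)$ is the matroid on $\binom{[n]}{2}$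 in which a set $S$ is independent if and only if $I_k(n)$ contains no nonzero polynomial in $\mathbb{K}[x_{i,j} : \{i,j\}\in S]$. Then this is indeed a matroid, all $(k+1)$-free sets of edges are independent in it, all $k$-triangulations are bases of it, and its rank equals $2nk-\binom{2k+1}{2}$. -/

import Mathlib

/-- The edges of the complete graph on `n` vertices `0 < 1 < ⋯ < n - 1` placed in this order along
a circle: the edge `{i, j}` with `i < j` is the pair `(i, j)`. -/
abbrev Edge (n : ℕ) : Type := {p : Fin n × Fin n // p.1 < p.2}

namespace Edge

/-- The smaller end-point. -/
def lo {n : ℕ} (e : Edge n) : Fin n := e.1.1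

/-- The larger end-point. -/
def hi {n : ℕ} (e : Edge n) : Fin n := e.1.2

/-- `e = {i, j}` and `f = {i', j'}` satisfy `i < i' < j < j'`. -/
def CrossLeft {n : ℕ} (e f : Edge n) : Prop := e.lo < f.lo ∧ f.lo < e.hi ∧ e.hi < f.hi

instance {n : ℕ} : DecidableRel (CrossLeft (n := n)) := fun e f =>
  inferInstanceAs (Decidable (e.lo < f.lo ∧ f.lo < e.hi ∧ e.hi < f.hi))

/-- The edges `{i, j}` and `{i', j'}` cross: `i < i' < j < j'` or `i' < i < j' < j`. -/
def Cross {n : ℕ} (e f : Edge n) : Prop := e.CrossLeft f ∨ f.CrossLeft e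

end Edge

/-- A `k`-crossing is a set of `k` edges that mutually cross each other. -/
def IsCrossing {n : ℕ} (k : ℕ) (C : Finset (Edge n)) : Prop :=
  C.card = k ∧ ∀ e ∈ C, ∀ f ∈ C, e ≠ f → e.Cross f

/-- A set of edges is `k`-free if it contains no `k`-crossing. -/
def IsCrossingFree {n : ℕ} (k : ℕ) (T : Set (Edge n)) : Prop :=
  ∀ C : Finset (Edge n), IsCrossing k C → ¬ (C : Set (Edge n)) ⊆ T

/-- A `k`-triangulation is a set of edges that is maximal (for inclusion) among the
`(k + 1)`-free ones. -/
def IsKTriangulation {n : ℕ} (k : ℕ) (T : Set (Edge n)) : Prop :=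
  Maximal (IsCrossingFree (k + 1)) T

/-- `E` is a perfect matching of the vertex set `U`: its edges have both end-points in `U` and every
vertex in `U` lies in exactly one of them. -/
def IsMatchingOn {n : ℕ} (U : Finset (Fin n)) (E : Finset (Edge n)) : Prop :=
  (∀ e ∈ E, e.lo ∈ U ∧ e.hi ∈ U) ∧ ∀ u ∈ U, (E.filter fun e => e.lo = u ∨ e.hi = u).card = 1

instance {n : ℕ} (U : Finset (Fin n)) : DecidablePred (IsMatchingOn U) := fun E =>
  inferInstanceAs (Decidable ((∀ e ∈ E, e.lo ∈ U ∧ e.hi ∈ U) ∧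
    ∀ u ∈ U, (E.filter fun e => e.lo = u ∨ e.hi = u).card = 1))

/-- The number of (unordered) pairs of edges of `E` that cross; each such pair is counted once, in
the order given by `Edge.CrossLeft`. -/
def crossingNumber {n : ℕ} (E : Finset (Edge n)) : ℕ :=
  ((E ×ˢ E).filter fun p => p.1.CrossLeft p.2).card

/-- The Pfaffian of the principal submatrix with rows and columns in `U` of the generic
antisymmetric `n × n` matrix, whose entry in position `(i, j)`, `i < j`, is the variable indexed
by the edge `{i, j}`: the sum over the perfect matchings of `U` of their monomials, with sign
given by the parity of the number of crossings. If `U` has `2 * d` elements, it has degree `d`. -/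
noncomputable def pfaffian (K : Type*) [Field K] {n : ℕ} (U : Finset (Fin n)) :
    MvPolynomial (Edge n) K :=
  ∑ E ∈ (Finset.univ : Finset (Finset (Edge n))).filter (IsMatchingOn U),
    (-1) ^ crossingNumber E * ∏ e ∈ E, MvPolynomial.X e

/-- The ideal `I_k(n)` generated by all the Pfaffians of degree `k + 1`, which defines the variety
`Pf_k(n)` of antisymmetric `n × n` matrices of rank at most `2 * k`. -/
noncomputable def pfaffianIdeal (K : Type*) [Field K] (k n : ℕ) :
    Ideal (MvPolynomial (Edge n) K) :=
  Ideal.span {f | ∃ U : Finset (Fin n), U.card = 2 * (k + 1) ∧ f = pfaffian K U}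

/-- `M` is the algebraic matroid of the ideal `I`: its elements are (the indices of) the variables
and a set `S` of them is independent if and only if `I` contains no nonzero polynomial in the
variables in `S` only. These two conditions determine `M`. -/
def IsAlgebraicMatroid {K : Type*} [Field K] {σ : Type*} (I : Ideal (MvPolynomial σ K))
    (M : Matroid σ) : Prop :=
  M.E = Set.univ ∧
    ∀ S : Set σ, M.Indep S ↔ ∀ f ∈ I, f ∈ MvPolynomial.supported K S → f = 0

/-!
The vanishing of all Pfaffians of degree `k + 1` characterizes, over a field, the antisymmetric
matrices of the form `∑ l, (a l) (b l)ᵀ - (b l) (a l)ᵀ` with `k` summands (`pf_sum_wedge_eq_zero`,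
`exists_eq_sum_wedge`). Hence a power of each polynomial that vanishes on the generic matrix
`genericSkew` of this form lies in `pfaffianIdeal`, and the algebraic matroid of the ideal is the
matroid of algebraic independence of the entries of `genericSkew`
(`isAlgebraicMatroid_skewMatroid`). The edges with an end-point among the first `2 k` vertices span
it, since an expansion of the Pfaffians on the first `2 k` vertices and two others determines the
remaining entries; this bounds the rank from above (`eRank_skewMatroid_le`).

It remains to show that each `k`-triangulation `T` is independent and has at least that many
elements. Both are read off from the pipe dream of `T` (`pipes`): the cells `(i, j)` of the `n × n`
square are read row by row, and the labels of the row `i` and of the column `j` turn in the cell if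
`{i, j} ∈ T` or `j ≤ i`, and go straight through it otherwise.

* For a set `T` of cells there is a matrix `Z` whose entries in `T` are algebraically independent,
  the other ones being chosen so that `(1, Z; 0, 1)` lies in the Bruhat cell given by the labels.
  It is built cell by cell (`IsGenericAt`): outside of `T` a linear equation is solved, and an entry
  in `T` is `y / t`, with new indeterminates `y` and `t`, where the other entries only change by
  multiples of `t`. Independence is therefore preserved, as it can be tested on initial forms
  (`algebraicIndepOn_of_eval_zero`). If at most `k` labels leave above the diagonal, then the upper
  triangle of `Z` agrees with that of a matrix `∑ l, (a l) (b l)ᵀ` with `k` summands. The upper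
  triangle of the latter is an initial form of an antisymmetric matrix of rank at most `2 k`, so
  that `T` is independent (`indep_skewMatroid_of_pipes`).
* A crossing is a chain of cells of `T` that go down and to the right, and along such a chain the
  number of labels of columns `≥ q` among the rows (`labelCount`) increases in each step
  (`card_le_labelCount`). For a `k`-triangulation this bound is attained, and labels that go
  straight through the same cell meet in increasing order
  (`IsKTriangulation.rowLabel_lt_colLabel`): otherwise a cell could be added to `T`. Maximality then
  determines the permutation in which the labels leave (`perm_eq_triangulationPerm`). At most `k`
  of them leave above the diagonal, and the cells outside of `T` correspond to distinct pairs of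
  labels that leave in increasing order, of which there are at most `(n - 2 k).choose 2`
  (`IsKTriangulation.ncard_compl_le`).
-/

/-! ### Pfaffians as sums over perfect matchings -/

theorem Edge.lo_lt_hi {n : ℕ} (e : Edge n) : e.lo < e.hi := e.2

theorem Edge.ext {n : ℕ} {e f : Edge n} (h₁ : e.lo = f.lo) (h₂ : e.hi = f.hi) : e = f :=
  Subtype.ext (Prod.ext h₁ h₂)

theorem isMatchingOn_iff {n : ℕ} {U : Finset (Fin n)} {E : Finset (Edge n)} :
    IsMatchingOn U E ↔ (∀ e ∈ E, ∀ u, (e.lo = u ∨ e.hi = u) → u ∈ U) ∧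
      (∀ u ∈ U, ∃ e ∈ E, e.lo = u ∨ e.hi = u) ∧
      (∀ e ∈ E, ∀ f ∈ E, ∀ u, (e.lo = u ∨ e.hi = u) → (f.lo = u ∨ f.hi = u) → e = f) := by
  constructor
  · rintro ⟨h1, h2⟩
    have h3 : ∀ e ∈ E, ∀ u, (e.lo = u ∨ e.hi = u) → u ∈ U := by
      rintro e he u (rfl | rfl)
      exacts [(h1 e he).1, (h1 e he).2]
    refine ⟨h3, fun u hu => ?_, fun e he f hf u heu hfu => ?_⟩
    · obtain ⟨e, he⟩ := Finset.card_eq_one.1 (h2 u hu)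
      have := he.symm.subset (Finset.mem_singleton_self e)
      rw [Finset.mem_filter] at this
      exact ⟨e, this⟩
    · exact Finset.card_le_one.1 (h2 u (h3 e he u heu)).le e (Finset.mem_filter.2 ⟨he, heu⟩) f
        (Finset.mem_filter.2 ⟨hf, hfu⟩)
  · rintro ⟨h1, h2, h3⟩
    refine ⟨fun e he => ⟨h1 e he _ (Or.inl rfl), h1 e he _ (Or.inr rfl)⟩, fun u hu => ?_⟩
    obtain ⟨e, he, heu⟩ := h2 u hu
    refine Finset.card_eq_one.2 ⟨e, ?_⟩
    ext f
    simp only [Finset.mem_filter, Finset.mem_singleton]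
    exact ⟨fun hf => h3 f hf.1 e he u hf.2 heu, fun hf => hf ▸ ⟨he, heu⟩⟩

/-- The set of end-points of the edges in `E`. -/
def vertexSet {n : ℕ} (E : Finset (Edge n)) : Finset (Fin n) :=
  E.biUnion fun e => {e.lo, e.hi}

theorem mem_vertexSet {n : ℕ} {E : Finset (Edge n)} {u : Fin n} :
    u ∈ vertexSet E ↔ ∃ e ∈ E, e.lo = u ∨ e.hi = u := by
  simp [vertexSet, eq_comm]

theorem IsMatchingOn.vertexSet_eq {n : ℕ} {U : Finset (Fin n)} {E : Finset (Edge n)}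
    (h : IsMatchingOn U E) : vertexSet E = U := by
  rw [isMatchingOn_iff] at h
  ext u
  rw [mem_vertexSet]
  exact ⟨fun ⟨e, he, heu⟩ => h.1 e he u heu, h.2.1 u⟩

theorem IsMatchingOn.of_subset {n : ℕ} {U : Finset (Fin n)} {E E₁ : Finset (Edge n)}
    (h : IsMatchingOn U E) (h₁ : E₁ ⊆ E) : IsMatchingOn (vertexSet E₁) E₁ := by
  rw [isMatchingOn_iff] at h ⊢
  exact ⟨fun e he u heu => mem_vertexSet.2 ⟨e, he, heu⟩, fun u hu => mem_vertexSet.1 hu,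
    fun e he f hf => h.2.2 e (h₁ he) f (h₁ hf)⟩

theorem IsMatchingOn.vertexSet_sdiff {n : ℕ} {U : Finset (Fin n)} {E E₁ : Finset (Edge n)}
    (h : IsMatchingOn U E) (h₁ : E₁ ⊆ E) : vertexSet (E \ E₁) = U \ vertexSet E₁ := by
  have hU := h.vertexSet_eq
  rw [isMatchingOn_iff] at h
  ext u
  simp only [Finset.mem_sdiff, mem_vertexSet, ← hU]
  constructor
  · rintro ⟨e, ⟨he, he'⟩, heu⟩
    refine ⟨⟨e, he, heu⟩, ?_⟩
    rintro ⟨f, hf, hfu⟩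
    exact he' (h.2.2 e he f (h₁ hf) u heu hfu ▸ hf)
  · rintro ⟨⟨e, he, heu⟩, h'⟩
    exact ⟨e, ⟨he, fun h'' => h' ⟨e, h'', heu⟩⟩, heu⟩

theorem IsMatchingOn.union {n : ℕ} {U V : Finset (Fin n)} {E F : Finset (Edge n)}
    (hE : IsMatchingOn U E) (hF : IsMatchingOn V F) (hUV : Disjoint U V) :
    IsMatchingOn (U ∪ V) (E ∪ F) := by
  rw [isMatchingOn_iff] at *
  rw [Finset.disjoint_left] at hUV
  refine ⟨?_, ?_, ?_⟩
  · intro e he u heu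
    rcases Finset.mem_union.1 he with he | he
    · exact Finset.mem_union_left _ (hE.1 e he u heu)
    · exact Finset.mem_union_right _ (hF.1 e he u heu)
  · intro u hu
    rcases Finset.mem_union.1 hu with hu | hu
    · obtain ⟨e, he, h⟩ := hE.2.1 u hu
      exact ⟨e, Finset.mem_union_left _ he, h⟩
    · obtain ⟨e, he, h⟩ := hF.2.1 u hu
      exact ⟨e, Finset.mem_union_right _ he, h⟩
  · intro e he f hf u heu hfu
    rcases Finset.mem_union.1 he with he | he <;> rcases Finset.mem_union.1 hf with hf | hf
    · exact hE.2.2 e he f hf u heu hfu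
    · exact (hUV (hE.1 e he u heu) (hF.1 f hf u hfu)).elim
    · exact (hUV (hE.1 f hf u hfu) (hF.1 e he u heu)).elim
    · exact hF.2.2 e he f hf u heu hfu

theorem IsMatchingOn.disjoint {n : ℕ} {U V : Finset (Fin n)} {E F : Finset (Edge n)}
    (hE : IsMatchingOn U E) (hF : IsMatchingOn V F) (hUV : Disjoint U V) : Disjoint E F := by
  rw [isMatchingOn_iff] at *
  rw [Finset.disjoint_left] at *
  exact fun e he hf => hUV (hE.1 e he _ (Or.inl rfl)) (hF.1 e hf _ (Or.inl rfl))

theorem IsMatchingOn.sum_eq {n : ℕ} {U : Finset (Fin n)} {E : Finset (Edge n)}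
    (h : IsMatchingOn U E) {A : Type*} [AddCommMonoid A] (g : Fin n → A) :
    ∑ u ∈ U, g u = ∑ e ∈ E, (g e.lo + g e.hi) := by
  rw [← h.vertexSet_eq, vertexSet, Finset.sum_biUnion]
  · exact Finset.sum_congr rfl fun e _ => Finset.sum_pair e.lo_lt_hi.ne
  · intro e he f hf hef
    rw [isMatchingOn_iff] at h
    simp only [Function.onFun]
    rw [Finset.disjoint_left]
    intro u hu hu'
    simp only [Finset.mem_insert, Finset.mem_singleton] at hu hu'
    exact hef (h.2.2 e he f hf u (hu.imp Eq.symm Eq.symm) (hu'.imp Eq.symm Eq.symm))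

theorem IsMatchingOn.card_eq {n : ℕ} {U : Finset (Fin n)} {E : Finset (Edge n)}
    (h : IsMatchingOn U E) : U.card = 2 * E.card := by
  rw [Finset.card_eq_sum_ones, h.sum_eq, Finset.sum_const, smul_eq_mul, mul_comm]

/-- The number of pairs `(v, w)` in `V × W` with `v < w`; its parity is the sign with which the
Pfaffians on `V` and on `W` are multiplied in the Pfaffian on `V ∪ W`. -/
def ascents {n : ℕ} (V W : Finset (Fin n)) : ℕ := ∑ v ∈ V, ∑ w ∈ W, if v < w then 1 else 0

/-- Two edges with four distinct end-points cross if and only if an odd number of the four pairs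
`(v, w)`, with `v` in the first edge and `w` in the second, satisfy `v < w`. -/
theorem neg_one_pow_crossingNumber_union {n : ℕ} {R : Type*} [CommRing R] {V W : Finset (Fin n)}
    {E F : Finset (Edge n)} (hE : IsMatchingOn V E) (hF : IsMatchingOn W F) (hVW : Disjoint V W) :
    (-1 : R) ^ crossingNumber (E ∪ F) =
      (-1) ^ ascents V W * ((-1) ^ crossingNumber E * (-1) ^ crossingNumber F) := by
  have hEF := hE.disjoint hF hVW
  have hc : ∀ G : Finset (Edge n), crossingNumber G =
      ∑ e ∈ G, ∑ f ∈ G, if e.CrossLeft f then 1 else 0 := by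
    intro G
    rw [crossingNumber, Finset.card_filter, Finset.sum_product]
  have h1 : crossingNumber (E ∪ F) = (∑ e ∈ E, ∑ f ∈ F,
      ((if e.CrossLeft f then 1 else 0) + (if f.CrossLeft e then 1 else 0))) +
      (crossingNumber E + crossingNumber F) := by
    simp only [hc, Finset.sum_union hEF, Finset.sum_add_distrib]
    rw [Finset.sum_comm (s := F) (t := E)]
    ring
  have h2 : ascents V W = ∑ e ∈ E, ∑ f ∈ F, (((if e.lo < f.lo then 1 else 0) +
      (if e.lo < f.hi then 1 else 0)) + ((if e.hi < f.lo then 1 else 0) +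
      (if e.hi < f.hi then 1 else 0))) := by
    rw [ascents, hE.sum_eq]
    refine Finset.sum_congr rfl fun e _ => ?_
    rw [hF.sum_eq, hF.sum_eq, ← Finset.sum_add_distrib]
  rw [h1, pow_add, pow_add, h2]
  congr 1
  rw [← Finset.prod_pow_eq_pow_sum, ← Finset.prod_pow_eq_pow_sum]
  refine Finset.prod_congr rfl fun e he => ?_
  rw [← Finset.prod_pow_eq_pow_sum, ← Finset.prod_pow_eq_pow_sum]
  refine Finset.prod_congr rfl fun f hf => ?_
  have hne : ∀ u, (e.lo = u ∨ e.hi = u) → ∀ v, (f.lo = v ∨ f.hi = v) → u ≠ v := by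
    rintro u hu v hv rfl
    exact Finset.disjoint_left.1 hVW ((isMatchingOn_iff.1 hE).1 e he u hu)
      ((isMatchingOn_iff.1 hF).1 f hf u hv)
  have a1 := hne _ (Or.inl rfl) _ (Or.inl rfl)
  have a2 := hne _ (Or.inl rfl) _ (Or.inr rfl)
  have a3 := hne _ (Or.inr rfl) _ (Or.inl rfl)
  have a4 := hne _ (Or.inr rfl) _ (Or.inr rfl)
  have b1 := e.lo_lt_hi
  have b2 := f.lo_lt_hi
  simp only [Edge.CrossLeft]
  rcases lt_or_gt_of_ne a1 with c1 | c1 <;> rcases lt_or_gt_of_ne a2 with c2 | c2 <;>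
    rcases lt_or_gt_of_ne a3 with c3 | c3 <;> rcases lt_or_gt_of_ne a4 with c4 | c4 <;>
    first
      | (norm_num [c1, c2, c3, c4, c1.not_gt, c2.not_gt, c3.not_gt, c4.not_gt]; done)
      | (exfalso; omega)

/-- The value at `x` of the Pfaffian on the vertex set `U`. -/
def pf {n : ℕ} {R : Type*} [CommRing R] (x : Edge n → R) (U : Finset (Fin n)) : R :=
  ∑ E ∈ (Finset.univ : Finset (Finset (Edge n))).filter (IsMatchingOn U),
    (-1) ^ crossingNumber E * ∏ e ∈ E, x e

theorem pfaffian_eq_pf (K : Type*) [Field K] {n : ℕ} (U : Finset (Fin n)) :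
    pfaffian K U = pf MvPolynomial.X U := rfl

theorem map_pf {n : ℕ} {R S : Type*} [CommRing R] [CommRing S] (f : R →+* S) (x : Edge n → R)
    (U : Finset (Fin n)) : f (pf x U) = pf (fun e => f (x e)) U := by
  simp [pf, map_sum, map_mul, map_prod]

theorem aeval_pfaffian {K : Type*} [Field K] {n : ℕ} {R : Type*} [CommRing R] [Algebra K R]
    (x : Edge n → R) (U : Finset (Fin n)) : MvPolynomial.aeval x (pfaffian K U) = pf x U := by
  have := map_pf (MvPolynomial.aeval (R := K) x).toRingHom MvPolynomial.X U
  simpa [pfaffian_eq_pf] using this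

theorem pf_congr {n : ℕ} {R : Type*} [CommRing R] {x y : Edge n → R} {U : Finset (Fin n)}
    (h : ∀ e : Edge n, e.lo ∈ U → e.hi ∈ U → x e = y e) : pf x U = pf y U := by
  refine Finset.sum_congr rfl fun E hE => ?_
  have hE := (Finset.mem_filter.1 hE).2
  congr 1
  exact Finset.prod_congr rfl fun e he => h e (hE.1 e he).1 (hE.1 e he).2

theorem pf_empty {n : ℕ} {R : Type*} [CommRing R] (x : Edge n → R) : pf x ∅ = 1 := by
  have : (Finset.univ : Finset (Finset (Edge n))).filter (IsMatchingOn ∅) = {∅} := by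
    ext E
    simp only [Finset.mem_filter, Finset.mem_univ, true_and, Finset.mem_singleton]
    constructor
    · intro h
      have := h.card_eq
      simpa using this
    · rintro rfl
      exact ⟨by simp, by simp⟩
  simp [pf, this, crossingNumber]

/-- The Pfaffian is zero if every perfect matching contains an edge of weight zero. -/
theorem pf_eq_zero {n : ℕ} {R : Type*} [CommRing R] {x : Edge n → R} {U : Finset (Fin n)}
    (h : ∀ E, IsMatchingOn U E → ∃ e ∈ E, x e = 0) : pf x U = 0 := by
  refine Finset.sum_eq_zero fun E hE => ?_
  obtain ⟨e, he, hx⟩ := h E (Finset.mem_filter.1 hE).2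
  rw [Finset.prod_eq_zero he hx, mul_zero]

/-- The Pfaffian of a sum: every edge of a perfect matching is given to one of the summands. -/
theorem pf_add {n : ℕ} {R : Type*} [CommRing R] (x y : Edge n → R) (U : Finset (Fin n)) :
    pf (fun e => x e + y e) U =
      ∑ V ∈ U.powerset, (-1) ^ ascents V (U \ V) * (pf x V * pf y (U \ V)) := by
  simp only [pf, Finset.prod_add, Finset.mul_sum, Finset.sum_mul]
  simp only [Finset.sum_sigma']
  refine Finset.sum_nbij' (fun a => ⟨vertexSet a.2, a.1 \ a.2, a.2⟩)
    (fun b => ⟨b.2.2 ∪ b.2.1, b.2.2⟩) ?_ ?_ ?_ ?_ ?_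
  · rintro ⟨E, E₁⟩ h
    simp only [Finset.mem_sigma, Finset.mem_filter, Finset.mem_univ, true_and,
      Finset.mem_powerset] at h ⊢
    refine ⟨?_, ?_, h.1.of_subset h.2⟩
    · intro u hu
      obtain ⟨e, he, heu⟩ := mem_vertexSet.1 hu
      exact (isMatchingOn_iff.1 h.1).1 e (h.2 he) u heu
    · rw [← h.1.vertexSet_sdiff h.2]
      exact h.1.of_subset Finset.sdiff_subset
  · rintro ⟨V, E₂, E₁⟩ h
    simp only [Finset.mem_sigma, Finset.mem_filter, Finset.mem_univ, true_and,
      Finset.mem_powerset] at h ⊢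
    refine ⟨?_, Finset.subset_union_left⟩
    have := h.2.2.union h.2.1 Finset.disjoint_sdiff
    rwa [Finset.union_sdiff_of_subset h.1] at this
  · rintro ⟨E, E₁⟩ h
    simp only [Finset.mem_sigma, Finset.mem_filter, Finset.mem_univ, true_and,
      Finset.mem_powerset] at h ⊢
    simp [Finset.union_sdiff_of_subset h.2]
  · rintro ⟨V, E₂, E₁⟩ h
    simp only [Finset.mem_sigma, Finset.mem_filter, Finset.mem_univ, true_and,
      Finset.mem_powerset] at h ⊢
    have hd := h.2.2.disjoint h.2.1 Finset.disjoint_sdiff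
    simp [h.2.2.vertexSet_eq, Finset.union_sdiff_cancel_left hd]
  · rintro ⟨E, E₁⟩ h
    simp only [Finset.mem_sigma, Finset.mem_filter, Finset.mem_univ, true_and,
      Finset.mem_powerset] at h ⊢
    have h1 := h.1.of_subset h.2
    have h2 := h.1.of_subset (Finset.sdiff_subset (s := E) (t := E₁))
    rw [h.1.vertexSet_sdiff h.2] at h2
    have h3 := neg_one_pow_crossingNumber_union (R := R) h1 h2 Finset.disjoint_sdiff
    rw [Finset.union_sdiff_of_subset h.2] at h3
    rw [h3]
    ring

theorem pf_eq_zero_of_odd {n : ℕ} {R : Type*} [CommRing R] (x : Edge n → R) {U : Finset (Fin n)}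
    (h : Odd U.card) : pf x U = 0 := by
  refine pf_eq_zero fun E hE => ?_
  rw [hE.card_eq] at h
  exact absurd h (by simp)

theorem pf_eq_zero_of_row {n : ℕ} {R : Type*} [CommRing R] {x : Edge n → R} {U : Finset (Fin n)}
    {u : Fin n} (hu : u ∈ U) (h : ∀ e : Edge n, e.lo = u ∨ e.hi = u → x e = 0) : pf x U = 0 := by
  refine pf_eq_zero fun E hE => ?_
  obtain ⟨e, he, heu⟩ := (isMatchingOn_iff.1 hE).2.1 u hu
  exact ⟨e, he, h e heu⟩

/-- A perfect matching with more than one edge is not contained in the star of a vertex. -/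
theorem pf_eq_zero_of_star {n : ℕ} {R : Type*} [CommRing R] {x : Edge n → R} {U : Finset (Fin n)}
    {u : Fin n} (hU : 2 < U.card) (h : ∀ e : Edge n, ¬(e.lo = u ∨ e.hi = u) → x e = 0) :
    pf x U = 0 := by
  refine pf_eq_zero fun E hE => ?_
  by_contra! hc
  have hE2 : 1 < E.card := by
    have := hE.card_eq
    omega
  obtain ⟨e, he, f, hf, hef⟩ := Finset.one_lt_card.1 hE2
  exact hef ((isMatchingOn_iff.1 hE).2.2 e he f hf u
    (not_not.1 fun h' => hc e he (h e h')) (not_not.1 fun h' => hc f hf (h f h')))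

theorem pf_pair {n : ℕ} {R : Type*} [CommRing R] (x : Edge n → R) (e : Edge n) :
    pf x {e.lo, e.hi} = x e := by
  have : (Finset.univ : Finset (Finset (Edge n))).filter (IsMatchingOn {e.lo, e.hi}) = {{e}} := by
    ext E
    simp only [Finset.mem_filter, Finset.mem_univ, true_and, Finset.mem_singleton]
    constructor
    · intro h
      have h1 := h.card_eq
      rw [Finset.card_pair e.lo_lt_hi.ne] at h1
      obtain ⟨f, rfl⟩ := Finset.card_eq_one.1 (show E.card = 1 by omega)
      have h2 := h.1 f (Finset.mem_singleton_self f)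
      have h3 := f.lo_lt_hi
      have h4 := e.lo_lt_hi
      simp only [Finset.mem_insert, Finset.mem_singleton] at h2
      rw [Finset.singleton_inj]
      rcases h2 with ⟨h5 | h5, h6 | h6⟩ <;> rw [h5, h6] at h3
      · exact absurd h3 (lt_irrefl _)
      · exact Edge.ext h5 h6
      · exact absurd h3 h4.not_gt
      · exact absurd h3 (lt_irrefl _)
    · rintro rfl
      rw [isMatchingOn_iff]
      simp [eq_comm]
  rw [pf, this]
  simp [crossingNumber, Edge.CrossLeft, Finset.filter_singleton]

/-- Expansion of a Pfaffian along the row of the vertex `u`. -/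
theorem pf_expand {n : ℕ} {R : Type*} [CommRing R] (x : Edge n → R) {U : Finset (Fin n)}
    {u : Fin n} (hu : u ∈ U) :
    pf x U = ∑ j ∈ U.erase u,
      (-1) ^ ascents {u, j} (U \ {u, j}) * (pf x {u, j} * pf x (U \ {u, j})) := by
  classical
  let y : Edge n → R := fun e => if e.lo = u ∨ e.hi = u then x e else 0
  let z : Edge n → R := fun e => if e.lo = u ∨ e.hi = u then 0 else x e
  have hx : x = fun e => y e + z e := by
    funext e
    simp only [y, z]
    split_ifs <;> simp
  have hinj : Set.InjOn (fun j => ({u, j} : Finset (Fin n))) (U.erase u) := by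
    intro i hi j hj hij
    have hi' : i ∈ ({u, j} : Finset (Fin n)) := by
      rw [← show ({u, i} : Finset (Fin n)) = {u, j} from hij]
      simp
    simp only [Finset.mem_insert, Finset.mem_singleton] at hi'
    exact hi'.resolve_left (Finset.ne_of_mem_erase hi)
  have hz : ∀ V : Finset (Fin n), u ∉ V → pf z V = pf x V := by
    intro V hV
    refine pf_congr fun e h1 h2 => if_neg ?_
    rintro (h | h)
    · exact hV (h ▸ h1)
    · exact hV (h ▸ h2)
  have hy : ∀ j, pf y {u, j} = pf x {u, j} := by
    intro j
    refine pf_congr fun e h1 h2 => if_pos ?_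
    by_contra! hc
    simp only [Finset.mem_insert, Finset.mem_singleton] at h1 h2
    exact e.lo_lt_hi.ne ((h1.resolve_left hc.1).trans (h2.resolve_left hc.2).symm)
  conv_lhs => rw [hx]
  rw [pf_add]
  rw [← Finset.sum_subset (s₁ := (U.erase u).image fun j => ({u, j} : Finset (Fin n)))]
  · rw [Finset.sum_image hinj]
    refine Finset.sum_congr rfl fun j hj => ?_
    rw [hy, hz _ (by simp)]
  · intro V hV
    obtain ⟨j, hj, rfl⟩ := Finset.mem_image.1 hV
    rw [Finset.mem_powerset]
    intro v hv
    simp only [Finset.mem_insert, Finset.mem_singleton] at hv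
    rcases hv with rfl | rfl
    exacts [hu, Finset.mem_of_mem_erase hj]
  · intro V hV hV'
    rw [Finset.mem_powerset] at hV
    by_cases huV : u ∈ V
    · have : pf y V = 0 := by
        rcases lt_or_ge 2 V.card with h2 | h2
        · exact pf_eq_zero_of_star (u := u) h2 fun e he => if_neg he
        · have h1 : 0 < V.card := Finset.card_pos.2 ⟨u, huV⟩
          have h3 : V.card ≠ 2 := by
            intro h
            have h4 : (V.erase u).card = 1 := by rw [Finset.card_erase_of_mem huV, h]
            obtain ⟨j, hj⟩ := Finset.card_eq_one.1 h4
            have h5 : j ∈ V.erase u := hj ▸ Finset.mem_singleton_self j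
            refine hV' (Finset.mem_image.2 ⟨j, Finset.erase_subset_erase u hV h5, ?_⟩)
            rw [← Finset.insert_erase huV, hj]
          have : V.card = 1 := by omega
          exact pf_eq_zero_of_odd _ (by rw [this]; exact odd_one)
      rw [this, zero_mul, mul_zero]
    · rw [pf_eq_zero_of_row (x := z) (Finset.mem_sdiff.2 ⟨hu, huV⟩) fun e he => if_pos he,
        mul_zero, mul_zero]

/-- The antisymmetric matrix `a bᵀ - b aᵀ` of rank at most two. -/
def wedge {n : ℕ} {R : Type*} [CommRing R] (a b : Fin n → R) (e : Edge n) : R :=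
  a e.lo * b e.hi - a e.hi * b e.lo

/-- The Plücker relation, and its consequence for larger Pfaffians. -/
theorem pf_wedge_eq_zero {n : ℕ} {R : Type*} [CommRing R] (a b : Fin n → R) {U : Finset (Fin n)}
    (hU : 2 < U.card) : pf (wedge a b) U = 0 := by
  rcases Nat.even_or_odd U.card with he | ho
  swap
  · exact pf_eq_zero_of_odd _ ho
  obtain ⟨m, hm⟩ : ∃ m, U.card = 2 * m + 4 := by
    obtain ⟨m, hm⟩ := he
    exact ⟨m - 2, by omega⟩
  clear he hU
  induction m generalizing U with
  | zero =>
    have h4 : U.card = 4 := by omega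
    let f := U.orderEmbOfFin h4
    have hU : U = {f 0, f 1, f 2, f 3} := by
      rw [← Finset.image_orderEmbOfFin_univ U h4]
      simp [Fin.univ_succ, f]
    have h01 : f 0 < f 1 := f.strictMono (by decide)
    have h12 : f 1 < f 2 := f.strictMono (by decide)
    have h23 : f 2 < f 3 := f.strictMono (by decide)
    generalize f 0 = p at *
    generalize f 1 = q at *
    generalize f 2 = r at *
    generalize f 3 = s at *
    have h02 := h01.trans h12
    have h03 := h02.trans h23
    have h13 := h12.trans h23
    rw [pf_expand _ (show p ∈ U by simp [hU])]
    have e0 : U.erase p = {q, r, s} := by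
      rw [hU, Finset.erase_insert]
      simp [h01.ne, h02.ne, h03.ne]
    have e1 : U \ {p, q} = {r, s} := by
      subst hU
      ext v
      simp only [Finset.mem_sdiff, Finset.mem_insert, Finset.mem_singleton]
      grind
    have e2 : U \ {p, r} = {q, s} := by
      subst hU
      ext v
      simp only [Finset.mem_sdiff, Finset.mem_insert, Finset.mem_singleton]
      grind
    have e3 : U \ {p, s} = {q, r} := by
      subst hU
      ext v
      simp only [Finset.mem_sdiff, Finset.mem_insert, Finset.mem_singleton]
      grind
    have hp : ∀ {i j : Fin n}, i < j → pf (wedge a b) {i, j} = a i * b j - a j * b i := by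
      intro i j hij
      exact pf_pair _ (⟨(i, j), hij⟩ : Edge n)
    rw [e0, Finset.sum_insert (by simp [h12.ne, h13.ne]), Finset.sum_pair h23.ne, e1, e2, e3,
      hp h01, hp h02, hp h03, hp h12, hp h13, hp h23]
    simp only [ascents, Finset.sum_pair h01.ne, Finset.sum_pair h02.ne, Finset.sum_pair h03.ne,
      Finset.sum_pair h12.ne, Finset.sum_pair h13.ne, Finset.sum_pair h23.ne, if_pos h01,
      if_pos h02, if_pos h03, if_pos h12, if_pos h13, if_pos h23, if_neg h12.not_gt,
      if_neg h13.not_gt, if_neg h23.not_gt]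
    ring
  | succ m ih =>
    obtain ⟨u, hu⟩ : U.Nonempty := Finset.card_pos.1 (by omega)
    rw [pf_expand _ hu]
    refine Finset.sum_eq_zero fun j hj => ?_
    rw [ih (U := U \ {u, j}), mul_zero, mul_zero]
    rw [Finset.card_sdiff_of_subset, Finset.card_pair (Finset.ne_of_mem_erase hj).symm]
    · omega
    · intro v hv
      simp only [Finset.mem_insert, Finset.mem_singleton] at hv
      rcases hv with rfl | rfl
      exacts [hu, Finset.mem_of_mem_erase hj]

/-- A sum of `d` antisymmetric matrices of rank two has no Pfaffians of degree more than `d`. -/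
theorem pf_sum_wedge_eq_zero {n : ℕ} {R : Type*} [CommRing R] {ι : Type*} (s : Finset ι)
    (a b : ι → Fin n → R) {U : Finset (Fin n)} (hU : 2 * s.card < U.card) :
    pf (fun e => ∑ l ∈ s, wedge (a l) (b l) e) U = 0 := by
  classical
  induction s using Finset.induction_on generalizing U with
  | empty =>
    obtain ⟨u, hu⟩ : U.Nonempty := Finset.card_pos.1 (by omega)
    exact pf_eq_zero_of_row hu fun e _ => by simp
  | insert l s hl ih =>
    simp only [Finset.sum_insert hl]
    rw [pf_add]
    refine Finset.sum_eq_zero fun V hV => ?_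
    rw [Finset.mem_powerset] at hV
    rcases lt_or_ge 2 V.card with h2 | h2
    · rw [pf_wedge_eq_zero _ _ h2, zero_mul, mul_zero]
    · rw [ih, mul_zero, mul_zero]
      rw [Finset.card_insert_of_notMem hl] at hU
      rw [Finset.card_sdiff_of_subset hV]
      omega

/-- Over a field, an antisymmetric matrix without nonzero Pfaffians of degree `k + 1` is a sum of
`k` antisymmetric matrices of rank two: a nonzero entry is used as a pivot, and the Pfaffians of
the remainder are those of the matrix divided by the pivot. -/
theorem exists_eq_sum_wedge {n : ℕ} {F : Type*} [Field F] (k : ℕ) (x : Edge n → F)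
    (hx : ∀ U : Finset (Fin n), U.card = 2 * (k + 1) → pf x U = 0) :
    ∃ a b : Fin k → Fin n → F, ∀ e, x e = ∑ l, wedge (a l) (b l) e := by
  classical
  induction k generalizing x with
  | zero =>
    refine ⟨0, 0, fun e => ?_⟩
    rw [← pf_pair x e, hx]
    · simp
    · rw [Finset.card_pair e.lo_lt_hi.ne]
  | succ k ih =>
    by_cases h0 : ∀ e, x e = 0
    · exact ⟨0, 0, fun e => by simp [h0, wedge]⟩
    push Not at h0
    obtain ⟨e₀, hc⟩ := h0
    let X : Fin n → Fin n → F := fun p q =>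
      if h : p < q then x ⟨(p, q), h⟩ else if h : q < p then -x ⟨(q, p), h⟩ else 0
    have hX : ∀ e : Edge n, X e.lo e.hi = x e := fun e => dif_pos e.lo_lt_hi
    have hX' : ∀ e : Edge n, X e.hi e.lo = -x e := fun e => by
      simp only [X, dif_neg e.lo_lt_hi.not_gt, dif_pos e.lo_lt_hi]
      rfl
    have hX0 : ∀ p, X p p = 0 := fun p => by simp [X]
    let a : Fin n → F := fun p => X e₀.lo p / x e₀
    let b : Fin n → F := fun p => X e₀.hi p
    let y : Edge n → F := fun e => x e - wedge a b e
    have hXs : ∀ p q, X p q = -X q p := by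
      intro p q
      rcases lt_trichotomy p q with h | h | h
      · simp [X, h, h.not_gt]
      · simp [X, h]
      · simp [X, h, h.not_gt]
    have hy1 : ∀ e : Edge n, e.lo = e₀.lo ∨ e.hi = e₀.lo → y e = 0 := by
      rintro e (h | h)
      · simp only [y, wedge, a, b, h, hX0, hX']
        rw [← h, hX]
        field_simp
        ring
      · simp only [y, wedge, a, b, h, hX0, hX']
        rw [hXs e₀.lo, ← h, hX]
        field_simp
        ring
    have hy2 : ∀ e : Edge n, e.lo = e₀.hi ∨ e.hi = e₀.hi → y e = 0 := by
      rintro e (h | h)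
      · simp only [y, wedge, a, b, h, hX0, hX]
        rw [← h, hX]
        field_simp
        ring
      · simp only [y, wedge, a, b, h, hX0, hX]
        rw [hXs e₀.hi, ← h, hX]
        field_simp
        ring
    obtain ⟨a', b', hab⟩ := ih y (by
      intro U hU
      by_cases h1 : e₀.lo ∈ U
      · exact pf_eq_zero_of_row h1 hy1
      by_cases h2 : e₀.hi ∈ U
      · exact pf_eq_zero_of_row h2 hy2
      have hd : Disjoint ({e₀.lo, e₀.hi} : Finset (Fin n)) U := by
        simp [h1, h2]
      have hW := hx ({e₀.lo, e₀.hi} ∪ U) (by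
        rw [Finset.card_union_of_disjoint hd, Finset.card_pair e₀.lo_lt_hi.ne, hU]
        ring)
      have hxy : x = fun e => wedge a b e + y e := by
        funext e
        simp [y]
      rw [hxy, pf_add, Finset.sum_eq_single ({e₀.lo, e₀.hi} : Finset (Fin n))] at hW
      · rw [Finset.union_sdiff_cancel_left hd, pf_pair] at hW
        have hw : wedge a b e₀ = x e₀ := by
          have := hy1 e₀ (Or.inl rfl)
          exact (sub_eq_zero.1 this).symm
        rw [hw] at hW
        simpa [hc] using hW
      · intro V hV hne
        rw [Finset.mem_powerset] at hV
        by_cases g1 : e₀.lo ∈ V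
        · by_cases g2 : e₀.hi ∈ V
          · have hs : ({e₀.lo, e₀.hi} : Finset (Fin n)) ⊆ V := by
              intro v hv
              simp only [Finset.mem_insert, Finset.mem_singleton] at hv
              rcases hv with rfl | rfl <;> assumption
            have := Finset.card_lt_card (Finset.ssubset_iff_subset_ne.2 ⟨hs, hne.symm⟩)
            rw [Finset.card_pair e₀.lo_lt_hi.ne] at this
            rw [pf_wedge_eq_zero _ _ this, zero_mul, mul_zero]
          · rw [pf_eq_zero_of_row (x := y) (u := e₀.hi) (by simp [g2]) hy2, mul_zero, mul_zero]
        · rw [pf_eq_zero_of_row (x := y) (u := e₀.lo) (by simp [g1]) hy1, mul_zero, mul_zero]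
      · intro h
        exact absurd (Finset.mem_powerset.2 Finset.subset_union_left) h)
    refine ⟨Fin.cons a a', Fin.cons b b', fun e => ?_⟩
    rw [Fin.sum_univ_succ]
    simp only [Fin.cons_zero, Fin.cons_succ]
    rw [← hab]
    simp [y]

/-- A Pfaffian is an affine function of each entry of the matrix. -/
theorem pf_eq_add_mul {n : ℕ} {R : Type*} [CommRing R] (x : Edge n → R) {V : Finset (Fin n)}
    (e : Edge n) (h1 : e.lo ∉ V) (h2 : e.hi ∉ V) :
    ∃ m : ℕ, pf x ({e.lo, e.hi} ∪ V) =
      pf (fun f => if f = e then 0 else x f) ({e.lo, e.hi} ∪ V) + (-1) ^ m * (x e * pf x V) := by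
  classical
  let y : Edge n → R := fun f => if f = e then x f else 0
  let z : Edge n → R := fun f => if f = e then 0 else x f
  have hx : x = fun f => y f + z f := by
    funext f
    simp only [y, z]
    split_ifs <;> simp
  have hd : Disjoint ({e.lo, e.hi} : Finset (Fin n)) V := by simp [h1, h2]
  refine ⟨ascents {e.lo, e.hi} V, ?_⟩
  conv_lhs => rw [hx, pf_add]
  rw [← Finset.sum_subset (s₁ := {∅, {e.lo, e.hi}}), Finset.sum_pair]
  · rw [Finset.union_sdiff_cancel_left hd, Finset.sdiff_empty, pf_empty, pf_pair]
    have : pf z V = pf x V := by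
      refine pf_congr fun f hf _ => if_neg ?_
      rintro rfl
      exact h1 hf
    rw [this]
    simp [ascents, y, z]
  · exact (Finset.insert_ne_empty _ _).symm
  · intro W hW
    simp only [Finset.mem_insert, Finset.mem_singleton] at hW
    rw [Finset.mem_powerset]
    rcases hW with rfl | rfl
    · exact Finset.empty_subset _
    · exact Finset.subset_union_left
  · intro W hW hW'
    have : pf y W = 0 := by
      refine pf_eq_zero fun E hE => ?_
      by_contra! hc
      have hE' : ∀ f ∈ E, f = e := fun f hf => by
        by_contra h
        exact hc f hf (if_neg h)
      rcases Finset.subset_singleton_iff.1 (fun f hf => Finset.mem_singleton.2 (hE' f hf) :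
        E ⊆ {e}) with rfl | rfl
      · exact hW' (by simp [← hE.vertexSet_eq, vertexSet])
      · exact hW' (by simp [← hE.vertexSet_eq, vertexSet])
    rw [this, zero_mul, mul_zero]

/-- The Pfaffian of a matrix supported on a single perfect matching is a product of entries. -/
theorem pf_ne_zero_of_isMatchingOn {n : ℕ} {F : Type*} [Field F] {U : Finset (Fin n)}
    {E : Finset (Edge n)} (hE : IsMatchingOn U E) {x : Edge n → F} (h : ∀ e, x e ≠ 0 ↔ e ∈ E) :
    pf x U ≠ 0 := by
  rw [pf, Finset.sum_eq_single E]
  · refine mul_ne_zero (by simp) (Finset.prod_ne_zero_iff.2 fun e he => (h e).2 he)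
  · intro E' hE' hne
    replace hE' := (Finset.mem_filter.1 hE').2
    have : ∃ e ∈ E', e ∉ E := by
      by_contra! hc
      refine hne (Finset.eq_of_subset_of_card_le hc ?_)
      have h1 := hE.card_eq
      have h2 := hE'.card_eq
      omega
    obtain ⟨e, he, he'⟩ := this
    rw [Finset.prod_eq_zero he (not_not.1 fun h' => he' ((h e).1 h')), mul_zero]
  · intro h'
    exact absurd (Finset.mem_filter.2 ⟨Finset.mem_univ _, hE⟩) h'

/-! ### The algebraic matroid of the Pfaffian variety -/

/-- The generic antisymmetric matrix of rank at most `2 * k`: the sum of `k` matrices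
`a bᵀ - b aᵀ` whose vectors `a` and `b` have independent indeterminates as coordinates. -/
noncomputable def genericSkew (K : Type*) [Field K] (k n : ℕ) :
    Edge n → MvPolynomial (Fin k × Fin n × Bool) K :=
  fun e => ∑ l, wedge (fun i => MvPolynomial.X (l, i, false))
    (fun i => MvPolynomial.X (l, i, true)) e

theorem map_genericSkew {K : Type*} [Field K] {k n : ℕ} {R : Type*} [CommRing R] [Algebra K R]
    (a b : Fin k → Fin n → R) (e : Edge n) :
    MvPolynomial.aeval (fun p : Fin k × Fin n × Bool => bif p.2.2 then b p.1 p.2.1 else a p.1 p.2.1)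
      (genericSkew K k n e) = ∑ l, wedge (a l) (b l) e := by
  simp [genericSkew, wedge]

/-- The matrices of the form `∑ (a bᵀ - b aᵀ)` satisfy all relations between the entries of the
generic one. -/
theorem aeval_sum_wedge_eq_zero {K : Type*} [Field K] {k n : ℕ} {f : MvPolynomial (Edge n) K}
    (hf : MvPolynomial.aeval (genericSkew K k n) f = 0) {R : Type*} [CommRing R] [Algebra K R]
    (a b : Fin k → Fin n → R) :
    MvPolynomial.aeval (fun e => ∑ l, wedge (a l) (b l) e) f = 0 := by
  have h := congrArg (MvPolynomial.aeval (R := K) fun p : Fin k × Fin n × Bool =>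
    bif p.2.2 then b p.1 p.2.1 else a p.1 p.2.1) hf
  rw [map_zero, ← AlgHom.comp_apply, MvPolynomial.comp_aeval] at h
  simpa only [map_genericSkew] using h

theorem aeval_genericSkew_of_mem {K : Type*} [Field K] {k n : ℕ} {f : MvPolynomial (Edge n) K}
    (hf : f ∈ pfaffianIdeal K k n) : MvPolynomial.aeval (genericSkew K k n) f = 0 := by
  have : pfaffianIdeal K k n ≤
      RingHom.ker (MvPolynomial.aeval (R := K) (genericSkew K k n)).toRingHom := by
    rw [pfaffianIdeal, Ideal.span_le]
    rintro f ⟨U, hU, rfl⟩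
    change MvPolynomial.aeval (genericSkew K k n) (pfaffian K U) = 0
    rw [aeval_pfaffian]
    refine pf_sum_wedge_eq_zero Finset.univ _ _ ?_
    simp only [Finset.card_univ, Fintype.card_fin]
    omega
  exact this hf

/-- The relations between the entries of the generic antisymmetric matrix of rank at most `2 * k`
lie in the radical of the Pfaffian ideal: modulo any prime ideal that contains the Pfaffians of
degree `k + 1`, the matrix of the variables is a specialization of it. -/
theorem mem_radical_of_aeval_genericSkew {K : Type*} [Field K] {k n : ℕ}
    {f : MvPolynomial (Edge n) K} (hf : MvPolynomial.aeval (genericSkew K k n) f = 0) :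
    f ∈ (pfaffianIdeal K k n).radical := by
  rw [Ideal.radical_eq_sInf, Ideal.mem_sInf]
  rintro P ⟨hIP, hP⟩
  let F := FractionRing (MvPolynomial (Edge n) K ⧸ P)
  let g : MvPolynomial (Edge n) K →ₐ[K] F :=
    (IsScalarTower.toAlgHom K (MvPolynomial (Edge n) K ⧸ P) F).comp (Ideal.Quotient.mkₐ K P)
  have hg : ∀ p, g p = 0 ↔ p ∈ P := by
    intro p
    change algebraMap (MvPolynomial (Edge n) K ⧸ P) F (Ideal.Quotient.mk P p) = 0 ↔ p ∈ P
    rw [FaithfulSMul.algebraMap_eq_zero_iff, Ideal.Quotient.eq_zero_iff_mem]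
  have hgx : MvPolynomial.aeval (fun e => g (MvPolynomial.X e)) = g := by
    ext e
    simp
  obtain ⟨a, b, hab⟩ := exists_eq_sum_wedge k (fun e => g (MvPolynomial.X e)) (by
    intro U hU
    rw [← aeval_pfaffian (K := K), hgx, hg]
    exact hIP (Ideal.subset_span ⟨U, hU, rfl⟩))
  have h := aeval_sum_wedge_eq_zero hf a b
  simp only [← hab] at h
  rw [hgx, hg] at h
  exact h

/-- The matroid of algebraic independence of the entries of the generic antisymmetric matrix of
rank at most `2 * k`. -/
noncomputable def skewMatroid (K : Type*) [Field K] (k n : ℕ) : Matroid (Edge n) :=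
  (AlgebraicIndependent.matroid K (MvPolynomial (Fin k × Fin n × Bool) K)).comap
    (genericSkew K k n)

theorem skewMatroid_indep_iff {K : Type*} [Field K] {k n : ℕ} {S : Set (Edge n)} :
    (skewMatroid K k n).Indep S ↔ ∀ f ∈ MvPolynomial.supported K S,
      MvPolynomial.aeval (genericSkew K k n) f = 0 → f = 0 := by
  rw [← algebraicIndependent_comp_subtype, skewMatroid, Matroid.comap_indep_iff,
    AlgebraicIndependent.matroid_indep_iff]
  constructor
  · rintro ⟨h1, h2⟩
    exact (algebraicIndependent_image h2).2 h1
  · intro h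
    have h2 : Set.InjOn (genericSkew K k n) S := Set.injOn_iff_injective.2 h.injective
    exact ⟨(algebraicIndependent_image h2).1 h, h2⟩

theorem isAlgebraicMatroid_skewMatroid (K : Type*) [Field K] (k n : ℕ) :
    IsAlgebraicMatroid (pfaffianIdeal K k n) (skewMatroid K k n) := by
  refine ⟨by simp [skewMatroid], fun S => ?_⟩
  rw [skewMatroid_indep_iff]
  constructor
  · exact fun h f hf hS => h f hS (aeval_genericSkew_of_mem hf)
  · intro h f hS hf
    obtain ⟨m, hm⟩ := mem_radical_of_aeval_genericSkew hf
    exact eq_zero_of_pow_eq_zero (h _ hm (pow_mem hS m))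

/-! ### The upper bound for the rank -/

theorem pf_mem {K R : Type*} [CommRing K] [CommRing R] [Algebra K R] {n : ℕ} (S : Subalgebra K R)
    {x : Edge n → R} {U : Finset (Fin n)} (h : ∀ e : Edge n, e.lo ∈ U → e.hi ∈ U → x e ∈ S) :
    pf x U ∈ S := by
  refine S.sum_mem fun E hE => S.mul_mem (S.pow_mem (S.neg_mem S.one_mem) _)
    (S.prod_mem fun e he => ?_)
  have := (Finset.mem_filter.1 hE).2.1 e he
  exact h e this.1 this.2

theorem card_edges_between (n a b : ℕ) (hb : b ≤ n) :
    ((Finset.univ : Finset (Edge n)).filter fun e => a ≤ (e.lo : ℕ) ∧ (e.hi : ℕ) < b).card =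
      (b - a).choose 2 := by
  classical
  let V : Finset (Fin n) := Finset.univ.filter fun i => a ≤ (i : ℕ) ∧ (i : ℕ) < b
  have hV : V.card = b - a := by
    rw [← Nat.card_Ico, ← Finset.card_map Fin.valEmbedding]
    congr 1
    ext i
    simp only [V, Finset.mem_map, Finset.mem_filter, Finset.mem_univ, true_and,
      Fin.valEmbedding_apply, Finset.mem_Ico]
    exact ⟨fun ⟨j, hj, h⟩ => h ▸ hj, fun h => ⟨⟨i, by omega⟩, h, rfl⟩⟩
  rw [← hV, ← Finset.card_powersetCard]
  refine Finset.card_bij (fun e _ => {e.lo, e.hi}) ?_ ?_ ?_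
  · intro e he
    have he := (Finset.mem_filter.1 he).2
    have := e.lo_lt_hi
    rw [Finset.mem_powersetCard, Finset.card_pair this.ne]
    refine ⟨fun v hv => ?_, rfl⟩
    simp only [Finset.mem_insert, Finset.mem_singleton] at hv
    simp only [V, Finset.mem_filter, Finset.mem_univ, true_and]
    rcases hv with rfl | rfl <;> omega
  · intro e he f hf hef
    have h1 := e.lo_lt_hi
    have h2 := f.lo_lt_hi
    have h3 : ∀ v, (v = e.lo ∨ v = e.hi) ↔ (v = f.lo ∨ v = f.hi) := fun v => by
      simpa using (Finset.ext_iff.1 hef v)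
    have h4 := (h3 e.lo).1 (Or.inl rfl)
    have h5 := (h3 e.hi).1 (Or.inr rfl)
    exact Edge.ext (by grind) (by grind)
  · intro s hs
    rw [Finset.mem_powersetCard] at hs
    obtain ⟨u, v, huv, rfl⟩ := Finset.card_eq_two.1 hs.2
    have hu := hs.1 (Finset.mem_insert_self u {v})
    have hv := hs.1 (Finset.mem_insert_of_mem (Finset.mem_singleton_self v))
    simp only [V, Finset.mem_filter, Finset.mem_univ, true_and] at hu hv
    rcases lt_or_gt_of_ne huv with h | h
    · refine ⟨⟨(u, v), h⟩, ?_, rfl⟩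
      simp only [Finset.mem_filter, Finset.mem_univ, true_and]
      exact ⟨hu.1, hv.2⟩
    · refine ⟨⟨(v, u), h⟩, ?_, Finset.pair_comm _ _⟩
      simp only [Finset.mem_filter, Finset.mem_univ, true_and]
      exact ⟨hv.1, hu.2⟩

theorem card_edge (n : ℕ) : Fintype.card (Edge n) = n.choose 2 := by
  have := card_edges_between n 0 n le_rfl
  rw [Finset.filter_true_of_mem fun e _ => ⟨Nat.zero_le _, e.hi.2⟩] at this
  simpa using this

theorem choose_two_eq_add {k n : ℕ} (hn : 2 * k + 2 ≤ n) :
    n.choose 2 = (2 * n * k - (2 * k + 1).choose 2) + (n - 2 * k).choose 2 := by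
  obtain ⟨m, rfl⟩ : ∃ m, n = 2 * k + m := ⟨n - 2 * k, by omega⟩
  rw [Nat.add_sub_cancel_left]
  have h2 : (2 * k + 1).choose 2 = 2 * k * k + k := by
    rw [Nat.choose_two_right, Nat.add_sub_cancel]
    rw [show (2 * k + 1) * (2 * k) = 2 * (2 * k * k + k) by ring]
    simp
  have h3 : (2 * k + m).choose 2 + k = 2 * k * k + 2 * k * m + m.choose 2 := by
    rw [Nat.add_choose_eq]
    have h4 : (2 * k).choose 2 + k = 2 * k * k := by
      rcases k with _ | k
      · rfl
      · rw [Nat.choose_two_right]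
        rw [show 2 * (k + 1) * (2 * (k + 1) - 1) = 2 * ((k + 1) * (2 * k + 1)) by
          rw [show 2 * (k + 1) - 1 = 2 * k + 1 by omega]
          ring]
        rw [Nat.mul_div_cancel_left _ (by norm_num)]
        ring
    simp [Finset.Nat.antidiagonal_succ]
    linarith
  have h5 : 2 * (2 * k + m) * k = 2 * k * k + k + (2 * k * k + 2 * k * m - k) := by
    have : k ≤ 2 * k * k := by nlinarith [Nat.zero_le k, Nat.le_mul_self k]
    zify [show k ≤ 2 * k * k + 2 * k * m by omega]
    ring
  have h6 : k ≤ 2 * k * k := by nlinarith [Nat.zero_le k, Nat.le_mul_self k]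
  rw [h2, h5]
  omega

/-- The Pfaffian on the first `2 * k` vertices does not vanish on the matrices of rank at most
`2 * k`. -/
theorem pf_genericSkew_ne_zero (K : Type*) [Field K] {k n : ℕ} (hn : 2 * k ≤ n) :
    pf (genericSkew K k n) (Finset.univ.filter fun i : Fin n => (i : ℕ) < 2 * k) ≠ 0 := by
  classical
  intro h
  let a : Fin k → Fin n → K := fun l i => if (i : ℕ) = 2 * l then 1 else 0
  let b : Fin k → Fin n → K := fun l i => if (i : ℕ) = 2 * l + 1 then 1 else 0
  let E : Finset (Edge n) := Finset.univ.filter fun e =>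
    ∃ l : Fin k, (e.lo : ℕ) = 2 * l ∧ (e.hi : ℕ) = 2 * l + 1
  have hE : IsMatchingOn (Finset.univ.filter fun i : Fin n => (i : ℕ) < 2 * k) E := by
    rw [isMatchingOn_iff]
    refine ⟨?_, ?_, ?_⟩
    · intro e he u hu
      obtain ⟨l, h1, h2⟩ := (Finset.mem_filter.1 he).2
      have := l.2
      simp only [Finset.mem_filter, Finset.mem_univ, true_and]
      rcases hu with rfl | rfl <;> omega
    · intro u hu
      simp only [Finset.mem_filter, Finset.mem_univ, true_and] at hu
      let e : Edge n := ⟨(⟨2 * (u / 2), by omega⟩, ⟨2 * (u / 2) + 1, by omega⟩),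
        by simp [Fin.lt_def]⟩
      refine ⟨e, Finset.mem_filter.2 ⟨Finset.mem_univ _, ⟨⟨u / 2, by omega⟩, rfl, rfl⟩⟩, ?_⟩
      rcases Nat.mod_two_eq_zero_or_one u with h | h
      · left
        exact Fin.ext (by change 2 * (u.1 / 2) = u.1; omega)
      · right
        exact Fin.ext (by change 2 * (u.1 / 2) + 1 = u.1; omega)
    · intro e he f hf u hu hu'
      obtain ⟨l, h1, h2⟩ := (Finset.mem_filter.1 he).2
      obtain ⟨m, h3, h4⟩ := (Finset.mem_filter.1 hf).2
      refine Edge.ext (Fin.ext ?_) (Fin.ext ?_) <;>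
        rcases hu with rfl | rfl <;> rcases hu' with h | h <;> have := congrArg Fin.val h <;> omega
  refine pf_ne_zero_of_isMatchingOn hE (x := fun e => ∑ l, wedge (a l) (b l) e) ?_ ?_
  · intro e
    have hw : ∀ l, wedge (a l) (b l) e =
        if (e.lo : ℕ) = 2 * l ∧ (e.hi : ℕ) = 2 * l + 1 then 1 else 0 := by
      intro l
      have h1 := Fin.lt_def.1 e.lo_lt_hi
      have h2 : ¬ ((e.hi : ℕ) = 2 * l ∧ (e.lo : ℕ) = 2 * l + 1) := by omega
      simp only [wedge, a, b, mul_ite, mul_one, mul_zero, ← ite_and]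
      rw [if_neg (show ¬((e.lo : ℕ) = 2 * l + 1 ∧ (e.hi : ℕ) = 2 * l) from
        fun h => h2 ⟨h.2, h.1⟩), sub_zero]
      exact if_congr and_comm rfl rfl
    simp only [hw, E, Finset.mem_filter, Finset.mem_univ, true_and]
    by_cases hl : ∃ l : Fin k, (e.lo : ℕ) = 2 * l ∧ (e.hi : ℕ) = 2 * l + 1
    · simp only [hl, iff_true]
      obtain ⟨l, hl⟩ := hl
      rw [Finset.sum_eq_single l, if_pos hl]
      · exact one_ne_zero
      · intro m _ hm
        refine if_neg fun h => hm (Fin.ext ?_)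
        omega
      · simp
    · simp only [hl, iff_false, not_not]
      push Not at hl
      exact Finset.sum_eq_zero fun l _ => if_neg fun h => hl l h.1 h.2
  · have h' := congrArg (MvPolynomial.aeval (R := K) fun p : Fin k × Fin n × Bool =>
      bif p.2.2 then b p.1 p.2.1 else a p.1 p.2.1) h
    rw [map_zero] at h'
    have h2 := map_pf (MvPolynomial.aeval (R := K) fun p : Fin k × Fin n × Bool =>
      bif p.2.2 then b p.1 p.2.1 else a p.1 p.2.1).toRingHom (genericSkew K k n)
      (Finset.univ.filter fun i : Fin n => (i : ℕ) < 2 * k)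
    simp only [AlgHom.toRingHom_eq_coe, RingHom.coe_coe, map_genericSkew] at h2
    rw [← h2]
    exact h'

/-- The entries in the first `2 * k` rows determine the other ones: the Pfaffian on the first
`2 * k` vertices and the end-points of `e` is linear in the entry at `e`. -/
theorem spanning_skewMatroid (K : Type*) [Field K] {k n : ℕ} (hn : 2 * k ≤ n) :
    (skewMatroid K k n).Spanning {e : Edge n | (e.lo : ℕ) < 2 * k} := by
  classical
  rw [Matroid.spanning_iff_ground_subset_closure (by simp [skewMatroid])]
  intro e _
  rw [skewMatroid, Matroid.comap_closure_eq, Set.mem_preimage,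
    AlgebraicIndependent.matroid_closure_eq, SetLike.mem_coe, Subalgebra.mem_algebraicClosure]
  set x := genericSkew K k n
  set S := Algebra.adjoin K (x '' {e : Edge n | (e.lo : ℕ) < 2 * k})
  have hS : ∀ f : Edge n, (f.lo : ℕ) < 2 * k → x f ∈ S := fun f hf =>
    Algebra.subset_adjoin ⟨f, hf, rfl⟩
  by_cases he : (e.lo : ℕ) < 2 * k
  · exact isAlgebraic_algebraMap (⟨x e, hS e he⟩ : S)
  have hlt := Fin.lt_def.1 e.lo_lt_hi
  let V : Finset (Fin n) := Finset.univ.filter fun i : Fin n => (i : ℕ) < 2 * k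
  have h1 : e.lo ∉ V := by simp only [V, Finset.mem_filter, Finset.mem_univ, true_and]; omega
  have h2 : e.hi ∉ V := by simp only [V, Finset.mem_filter, Finset.mem_univ, true_and]; omega
  obtain ⟨m, hm⟩ := pf_eq_add_mul x e h1 h2
  have hVc : V.card = 2 * k := by
    rw [← Finset.card_range (2 * k), ← Finset.card_map Fin.valEmbedding]
    congr 1
    ext i
    simp only [V, Finset.mem_map, Finset.mem_filter, Finset.mem_univ, true_and,
      Fin.valEmbedding_apply, Finset.mem_range]
    exact ⟨fun ⟨j, hj, h⟩ => h ▸ hj, fun h => ⟨⟨i, by omega⟩, h, rfl⟩⟩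
  have hd : Disjoint ({e.lo, e.hi} : Finset (Fin n)) V := by simp [h1, h2]
  have h0 : pf x ({e.lo, e.hi} ∪ V) = 0 := by
    refine pf_sum_wedge_eq_zero Finset.univ _ _ ?_
    rw [Finset.card_union_of_disjoint hd, Finset.card_pair e.lo_lt_hi.ne, hVc]
    simp
  have hQ : pf x V ∈ S := pf_mem S fun f hf _ => hS f (Finset.mem_filter.1 hf).2
  have hP : pf (fun f => if f = e then 0 else x f) ({e.lo, e.hi} ∪ V) ∈ S := by
    refine pf_mem S fun f hf hf' => ?_
    by_cases hfe : f = e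
    · simp [hfe]
    · rw [if_neg hfe]
      refine hS f ?_
      have hlt' := Fin.lt_def.1 f.lo_lt_hi
      simp only [Finset.mem_union, Finset.mem_insert, Finset.mem_singleton, V, Finset.mem_filter,
        Finset.mem_univ, true_and] at hf hf'
      by_contra hc
      have g1 := hf.resolve_right hc
      have g2 := hf'.resolve_right (by omega)
      refine hfe (Edge.ext ?_ ?_) <;> rcases g1 with g1 | g1 <;> rcases g2 with g2 | g2 <;>
        first
          | assumption
          | (exfalso; rw [g1, g2] at hlt'; omega)
  have hQ0 : (⟨pf x V, hQ⟩ : S) ≠ 0 := fun h =>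
    pf_genericSkew_ne_zero K hn (congrArg Subtype.val h)
  refine ⟨Polynomial.C ((-1) ^ m * ⟨pf x V, hQ⟩) * Polynomial.X + Polynomial.C ⟨_, hP⟩, ?_, ?_⟩
  · intro h
    have := congrArg (fun p => Polynomial.coeff p 1) h
    simp only [Polynomial.coeff_add, Polynomial.coeff_C_mul, Polynomial.coeff_X_one, mul_one,
      Polynomial.coeff_C_succ, add_zero, Polynomial.coeff_zero, mul_eq_zero] at this
    rcases this with h' | h'
    · exact absurd h' (by simp)
    · exact hQ0 h'
  · rw [h0] at hm
    simp only [map_add, map_mul, Polynomial.aeval_C, Polynomial.aeval_X, map_pow, map_neg, map_one]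
    change (-1) ^ m * pf x V * x e + pf (fun f => if f = e then 0 else x f) _ = 0
    linear_combination -hm

theorem eRank_skewMatroid_le (K : Type*) [Field K] {k n : ℕ} (hn : 2 * k + 2 ≤ n) :
    (skewMatroid K k n).eRank ≤ ((2 * n * k - (2 * k + 1).choose 2 : ℕ) : ℕ∞) := by
  classical
  rw [← (spanning_skewMatroid K (show 2 * k ≤ n by omega)).eRk_eq]
  refine (Matroid.eRk_le_encard _ _).trans ?_
  have h1 := card_edges_between n (2 * k) n le_rfl
  have h2 := card_edge n
  have h3 := choose_two_eq_add hn
  have h4 := Finset.card_filter_add_card_filter_not (s := (Finset.univ : Finset (Edge n)))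
    (fun e => 2 * k ≤ (e.lo : ℕ) ∧ (e.hi : ℕ) < n)
  have h5 : {e : Edge n | (e.lo : ℕ) < 2 * k} = ((Finset.univ : Finset (Edge n)).filter
      (fun e => ¬ (2 * k ≤ (e.lo : ℕ) ∧ (e.hi : ℕ) < n)) : Finset (Edge n)) := by
    ext e
    simp
  rw [h5, Set.encard_coe_eq_coe_finsetCard, Nat.cast_le]
  rw [Finset.card_univ] at h4
  omega

/-! ### Algebraic independence from initial forms -/

/-- If the elements `x e`, multiplied by suitable powers of the indeterminate, become polynomials
whose constant terms are algebraically independent, then the `x e` are algebraically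
independent. -/
theorem algebraicIndepOn_of_eval_zero {K F σ : Type*} [Field K] [Field F] [Algebra K F]
    {S : Set σ} (m : σ → ℕ) (P : σ → Polynomial F) (x : σ → RatFunc F)
    (hx : ∀ e ∈ S, x e * RatFunc.X ^ m e = algebraMap (Polynomial F) (RatFunc F) (P e))
    (hP : AlgebraicIndepOn K (fun e => (P e).eval 0) S) : AlgebraicIndepOn K x S := by
  classical
  have hP' := (algebraicIndependent_comp_subtype (x := fun e => (P e).eval 0)).1 hP
  refine (algebraicIndependent_comp_subtype (x := x)).2 fun f hS hf => ?_
  by_contra hf0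
  have hne : f.support.Nonempty := MvPolynomial.support_nonempty.2 hf0
  obtain ⟨α₀, hα₀, hmax⟩ := f.support.exists_max_image (fun α => Finsupp.weight m α) hne
  set d := Finsupp.weight m α₀
  rw [MvPolynomial.mem_supported] at hS
  have hvars : ∀ α ∈ f.support, ∀ i ∈ α.support, i ∈ S := fun α hα i hi =>
    hS ((MvPolynomial.mem_vars_iff_mem_support _).2 ⟨α, hα, hi⟩)
  -- `g` is the relation `f` between the `x e`, multiplied by the power of the indeterminate that
  -- turns it into a relation between the `P e`
  let g : Polynomial F := ∑ α ∈ f.support, Polynomial.C (algebraMap K F (f.coeff α)) *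
    (Polynomial.X ^ (d - Finsupp.weight m α) * ∏ i ∈ α.support, P i ^ α i)
  have hmon : ∀ α ∈ f.support, (∏ i ∈ α.support, x i ^ α i) * RatFunc.X ^ Finsupp.weight m α =
      algebraMap (Polynomial F) (RatFunc F) (∏ i ∈ α.support, P i ^ α i) := by
    intro α hα
    rw [Finsupp.weight_apply, Finsupp.sum, ← Finset.prod_pow_eq_pow_sum, ← Finset.prod_mul_distrib,
      map_prod]
    refine Finset.prod_congr rfl fun i hi => ?_
    rw [map_pow, ← hx i (hvars α hα i hi), mul_pow, ← pow_mul, smul_eq_mul, mul_comm (α i)]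
  have hg : g = 0 := by
    apply RatFunc.algebraMap_injective F
    rw [map_zero]
    have h1 : algebraMap (Polynomial F) (RatFunc F) g =
        MvPolynomial.aeval x f * RatFunc.X ^ d := by
      rw [MvPolynomial.aeval_def, MvPolynomial.eval₂_eq, Finset.sum_mul, map_sum]
      refine Finset.sum_congr rfl fun α hα => ?_
      rw [map_mul, map_mul, ← hmon α hα, map_pow, RatFunc.algebraMap_X]
      have h2 : algebraMap (Polynomial F) (RatFunc F) (Polynomial.C (algebraMap K F (f.coeff α))) =
          algebraMap K (RatFunc F) (f.coeff α) := by
        rw [IsScalarTower.algebraMap_apply K (Polynomial F) (RatFunc F)]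
        rfl
      rw [h2, ← Nat.sub_add_cancel (hmax α hα), pow_add]
      simp only [Nat.add_sub_cancel]
      ring
    rw [h1, hf, zero_mul]
  -- at zero, only the part of `f` of highest weight survives in `g`
  let f' := MvPolynomial.weightedHomogeneousComponent m d f
  have hcoeff : ∀ α, f'.coeff α = if Finsupp.weight m α = d then f.coeff α else 0 :=
    fun α => MvPolynomial.coeff_weightedHomogeneousComponent (w := m) d f α
  have hsub : f'.support ⊆ f.support := by
    intro α hα
    rw [MvPolynomial.mem_support_iff, hcoeff] at hα
    rw [MvPolynomial.mem_support_iff]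
    exact fun h => hα (by rw [h, ite_self])
  have hf' : f' = 0 := by
    refine hP' f' ?_ ?_
    · rw [MvPolynomial.mem_supported]
      intro i hi
      obtain ⟨α, hα, hi⟩ := (MvPolynomial.mem_vars_iff_mem_support _).1 hi
      exact hvars α (hsub hα) i hi
    · have h1 := congrArg (Polynomial.eval 0) hg
      rw [Polynomial.eval_zero, Polynomial.eval_finsetSum] at h1
      rw [MvPolynomial.aeval_def, MvPolynomial.eval₂_eq, Finset.sum_subset hsub]
      · refine Eq.trans ?_ h1
        refine Finset.sum_congr rfl fun α hα => ?_
        rw [hcoeff, Polynomial.eval_mul, Polynomial.eval_mul, Polynomial.eval_C,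
          Polynomial.eval_pow, Polynomial.eval_X, Polynomial.eval_prod]
        have h2 := hmax α hα
        by_cases h : Finsupp.weight m α = d
        · simp [h]
        · have h3 : d - Finsupp.weight m α ≠ 0 := by
            have : Finsupp.weight m α ≤ d := h2
            omega
          simp [h, h3]
      · intro α _ hα
        rw [MvPolynomial.notMem_support_iff.1 hα, map_zero, zero_mul]
  have := hcoeff α₀
  rw [hf', if_pos rfl, MvPolynomial.coeff_zero] at this
  exact MvPolynomial.mem_support_iff.1 hα₀ this.symm

/-! ### Pipe dreams -/

/-- The position of a cell of the `n × n` square when the cells are read row by row. -/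
def cellIndex {n : ℕ} (c : Fin n × Fin n) : ℕ := c.1 * n + c.2

theorem cellIndex_lt_iff {n : ℕ} (c d : Fin n × Fin n) :
    cellIndex c < cellIndex d ↔ c.1 < d.1 ∨ c.1 = d.1 ∧ c.2 < d.2 := by
  obtain ⟨⟨a, ha⟩, ⟨b, hb⟩⟩ := c
  obtain ⟨⟨a', ha'⟩, ⟨b', hb'⟩⟩ := d
  simp only [cellIndex, Fin.mk_lt_mk, Fin.mk.injEq]
  rcases lt_trichotomy a a' with h | h | h
  · have : (a + 1) * n ≤ a' * n := Nat.mul_le_mul_right _ h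
    rw [Nat.add_mul, one_mul] at this
    omega
  · subst h
    simp
  · have : (a' + 1) * n ≤ a * n := Nat.mul_le_mul_right _ h
    rw [Nat.add_mul, one_mul] at this
    omega

theorem cellIndex_injective {n : ℕ} : Function.Injective (cellIndex (n := n)) := by
  intro c d h
  have h1 := cellIndex_lt_iff c d
  have h2 := cellIndex_lt_iff d c
  rw [h] at h1
  rw [h] at h2
  simp only [lt_irrefl, false_iff, not_or, not_and] at h1 h2
  have h3 : c.1 = d.1 := le_antisymm (not_lt.1 h2.1) (not_lt.1 h1.1)
  exact Prod.ext h3 (le_antisymm (not_lt.1 (h2.2 h3.symm)) (not_lt.1 (h1.2 h3)))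

theorem cellIndex_lt {n : ℕ} (c : Fin n × Fin n) : cellIndex c < n * n := by
  have : (c.1.1 + 1) * n ≤ n * n := Nat.mul_le_mul_right _ c.1.2
  rw [Nat.add_mul, one_mul] at this
  have := c.2.2
  unfold cellIndex
  omega

theorem exists_cellIndex_eq {n r : ℕ} (hr : r < n * n) : ∃ c : Fin n × Fin n, cellIndex c = r := by
  have hn : 0 < n := Nat.pos_of_ne_zero (by rintro rfl; omega)
  exact ⟨(⟨r / n, Nat.div_lt_of_lt_mul hr⟩, ⟨r % n, Nat.mod_lt _ hn⟩), Nat.div_add_mod' r n⟩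

open Classical in
/-- The strands of the pipe dream of a set `T` of cells of the `n × n` square, after the first `r`
cells have been read. There is a strand `Sum.inl i` for each row `i` and a strand `Sum.inr j` for
each column `j`, each of which starts with its own name as its label; reading the cell `(i, j)`
swaps the labels on the strands of the row `i` and the column `j` if the cell belongs to `T`. Thus
a label that enters a cell of `T` turns in it, and one that enters any other cell goes straight. -/
noncomputable def pipes {n : ℕ} (T : Set (Fin n × Fin n)) : ℕ → Equiv.Perm (Fin n ⊕ Fin n)
  | 0 => 1
  | r + 1 => if h : ∃ c ∈ T, cellIndex c = r then
      pipes T r * Equiv.swap (Sum.inl h.choose.1) (Sum.inr h.choose.2) else pipes T r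

@[simp]
theorem pipes_zero {n : ℕ} (T : Set (Fin n × Fin n)) : pipes T 0 = 1 := rfl

theorem pipes_succ_of_mem {n : ℕ} {T : Set (Fin n × Fin n)} {c : Fin n × Fin n} (hc : c ∈ T) :
    pipes T (cellIndex c + 1) =
      pipes T (cellIndex c) * Equiv.swap (Sum.inl c.1) (Sum.inr c.2) := by
  have h : ∃ d ∈ T, cellIndex d = cellIndex c := ⟨c, hc, rfl⟩
  rw [pipes, dif_pos h, cellIndex_injective h.choose_spec.2]

theorem pipes_succ_of_notMem {n : ℕ} {T : Set (Fin n × Fin n)} {c : Fin n × Fin n} (hc : c ∉ T) :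
    pipes T (cellIndex c + 1) = pipes T (cellIndex c) := by
  rw [pipes, dif_neg]
  rintro ⟨d, hd, h⟩
  exact hc (cellIndex_injective h ▸ hd)

/-- The order in which the strands are met, from the lower left to the upper right, along the
staircase that separates the first `r` cells from the others: rows are met downwards, columns are
met from right to left, and a row precedes a column if and only if the cell they share has been
read. -/
def Before {n : ℕ} (r : ℕ) : Fin n ⊕ Fin n → Fin n ⊕ Fin n → Prop
  | Sum.inl a, Sum.inl b => a < b
  | Sum.inr a, Sum.inr b => b < a
  | Sum.inl a, Sum.inr b => cellIndex (a, b) < r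
  | Sum.inr b, Sum.inl a => r ≤ cellIndex (a, b)

theorem Before.asymm {n r : ℕ} {x y : Fin n ⊕ Fin n} (h : Before r x y) : ¬ Before r y x := by
  rcases x with a | b <;> rcases y with a' | b' <;> simp only [Before] at h ⊢ <;> omega

theorem Before.ne {n r : ℕ} {x y : Fin n ⊕ Fin n} (h : Before r x y) : x ≠ y :=
  fun hxy => h.asymm (hxy ▸ hxy ▸ h)

/-- Reading the cell `c` changes the order of the strands only by exchanging the row and the column
of `c`, which are adjacent in it. -/
theorem before_succ_iff {n : ℕ} (c : Fin n × Fin n) (x y : Fin n ⊕ Fin n) :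
    Before (cellIndex c + 1) x y ↔ Before (cellIndex c)
      (Equiv.swap (Sum.inl c.1) (Sum.inr c.2) x) (Equiv.swap (Sum.inl c.1) (Sum.inr c.2) y) := by
  obtain ⟨i, j⟩ := c
  have h1 := fun d : Fin n × Fin n => (cellIndex_lt_iff d (i, j))
  have h2 := fun d : Fin n × Fin n => (cellIndex_lt_iff (i, j) d)
  have h3 : ∀ d : Fin n × Fin n, cellIndex d < cellIndex (i, j) + 1 ↔
      ¬ cellIndex (i, j) < cellIndex d := by
    intro d; omega
  have h4 : ∀ d : Fin n × Fin n, cellIndex (i, j) + 1 ≤ cellIndex d ↔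
      cellIndex (i, j) < cellIndex d := by
    intro d; omega
  have h5 : ∀ d : Fin n × Fin n, cellIndex (i, j) ≤ cellIndex d ↔
      ¬ cellIndex d < cellIndex (i, j) := by
    intro d; omega
  rcases x with a | b <;> rcases y with a' | b' <;>
    simp only [Equiv.swap_apply_def, Sum.inl.injEq, Sum.inr.injEq, reduceCtorEq, if_false] <;>
    split_ifs <;> simp only [Before, h1, h2, h3, h4, h5] <;> first | omega | grind

theorem before_succ_of_ne {n : ℕ} {c : Fin n × Fin n} {x y : Fin n ⊕ Fin n}
    (h : Before (cellIndex c + 1) x y) (hxy : ¬ (x = Sum.inl c.1 ∧ y = Sum.inr c.2)) :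
    Before (cellIndex c) x y := by
  obtain ⟨i, j⟩ := c
  rcases x with a | b <;> rcases y with a' | b' <;>
    simp only [Before, Sum.inl.injEq, Sum.inr.injEq, reduceCtorEq, false_and] at h hxy ⊢
  · exact h
  · have := mt (@cellIndex_injective n (a, b') (i, j)) (by simpa using hxy)
    omega
  · omega
  · exact h

/-! ### A generic matrix with prescribed ranks -/

/-- The rows of the matrix `(1, Z; 0, 1) * Y`, where `Z` occupies the block of rows `Sum.inl` and
columns `Sum.inr`. -/
def shearRow {n : ℕ} {F : Type*} [Field F] (Z : Fin n → Fin n → F)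
    (Y : Fin n ⊕ Fin n → Fin n ⊕ Fin n → F) : Fin n ⊕ Fin n → Fin n ⊕ Fin n → F
  | Sum.inl i, c => Y (Sum.inl i) c + ∑ j, Z i j * Y (Sum.inr j) c
  | Sum.inr j, c => Y (Sum.inr j) c

/-- The conditions on a matrix `Z` with entries in `F` that are maintained while the cells are read.
The entries of `Z` in the cells of `T` read so far are members of the family `y`, which is
algebraically independent over `K` and also has a member for each cell that is still to be read;
the entries in the latter cells vanish. The matrix `Y` is unitriangular, and `(1, Z; 0, 1) * Y`,
with columns permuted by the pipe dream of `T`, is triangular with nonzero diagonal entries. -/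
structure IsGenericAt (K : Type*) [Field K] {n : ℕ} (T : Set (Fin n × Fin n)) (r : ℕ) {F : Type*}
    [Field F] [Algebra K F] (y : Fin n × Fin n → F) (Z : Fin n → Fin n → F)
    (Y : Fin n ⊕ Fin n → Fin n ⊕ Fin n → F) : Prop where
  indep : AlgebraicIndepOn K y {c | c ∈ T ∨ r ≤ cellIndex c}
  eq_of_mem : ∀ c ∈ T, cellIndex c < r → Z c.1 c.2 = y c
  eq_zero : ∀ c : Fin n × Fin n, r ≤ cellIndex c → Z c.1 c.2 = 0
  diag : ∀ c, Y c c = 1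
  tri : ∀ c d, Before 0 c d → Y d c = 0
  row_diag : ∀ x, shearRow Z Y x (pipes T r x) ≠ 0
  row_tri : ∀ x z, Before r x z → shearRow Z Y x (pipes T r z) = 0

theorem IsGenericAt.zero (K : Type*) [Field K] {n : ℕ} (T : Set (Fin n × Fin n)) {F : Type*}
    [Field F] [Algebra K F] {y : Fin n × Fin n → F} (hy : AlgebraicIndependent K y) :
    IsGenericAt K T 0 y 0 (fun c d => if c = d then 1 else 0) where
  indep := hy.comp _ Subtype.val_injective
  eq_of_mem _ _ h := absurd h (Nat.not_lt_zero _)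
  eq_zero _ _ := rfl
  diag _ := if_pos rfl
  tri _ _ h := if_neg h.ne.symm
  row_diag x := by cases x <;> simp [shearRow]
  row_tri x z h := by
    have := h.ne
    cases x <;> simp [shearRow, this]

/-- Reading a cell outside of `T`: its entry is chosen so as to keep the matrix triangular. -/
theorem IsGenericAt.succ_of_notMem {K : Type*} [Field K] {n : ℕ} {T : Set (Fin n × Fin n)}
    {F : Type*} [Field F] [Algebra K F] {y : Fin n × Fin n → F} {Z : Fin n → Fin n → F}
    {Y : Fin n ⊕ Fin n → Fin n ⊕ Fin n → F} {c : Fin n × Fin n}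
    (h : IsGenericAt K T (cellIndex c) y Z Y) (hc : c ∉ T) :
    ∃ Z', IsGenericAt K T (cellIndex c + 1) y Z' Y := by
  classical
  set B := fun x z => shearRow Z Y x (pipes T (cellIndex c) z) with hB
  set ζ := - B (Sum.inl c.1) (Sum.inr c.2) / B (Sum.inr c.2) (Sum.inr c.2)
  have hff : B (Sum.inr c.2) (Sum.inr c.2) ≠ 0 := h.row_diag _
  have hfe : B (Sum.inr c.2) (Sum.inl c.1) = 0 := h.row_tri _ _ (le_refl (cellIndex c))
  have hZc : Z c.1 c.2 = 0 := h.eq_zero c le_rfl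
  let Z' : Fin n → Fin n → F := fun a b => Z a b + if a = c.1 ∧ b = c.2 then ζ else 0
  have hZ' : ∀ d : Fin n × Fin n, d ≠ c → Z' d.1 d.2 = Z d.1 d.2 := fun d hd => by
    have : ¬ (d.1 = c.1 ∧ d.2 = c.2) := fun h => hd (Prod.ext h.1 h.2)
    simp [Z', this]
  have hne : ∀ x, x ≠ Sum.inl c.1 → ∀ z, shearRow Z' Y x z = shearRow Z Y x z := by
    intro x hx z
    rcases x with a | b
    · have : a ≠ c.1 := fun h => hx (congrArg _ h)
      simp [shearRow, Z', this]
    · rfl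
  have he : ∀ z, shearRow Z' Y (Sum.inl c.1) z =
      shearRow Z Y (Sum.inl c.1) z + ζ * shearRow Z Y (Sum.inr c.2) z := by
    intro z
    simp [shearRow, Z', add_mul, Finset.sum_add_distrib, add_assoc]
  refine ⟨Z', ?_, ?_, ?_, h.diag, h.tri, ?_, ?_⟩
  · refine h.indep.mono ?_
    rintro d (hd | hd)
    · exact Or.inl hd
    · exact Or.inr (by omega)
  · intro d hd hdr
    have hdc : d ≠ c := fun e => hc (e ▸ hd)
    have := mt (@cellIndex_injective n d c) hdc
    rw [hZ' d hdc, h.eq_of_mem d hd (by omega)]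
  · intro d hd
    have hdc : d ≠ c := by rintro rfl; omega
    rw [hZ' d hdc, h.eq_zero d (by omega)]
  · intro x
    rw [pipes_succ_of_notMem hc]
    by_cases hx : x = Sum.inl c.1
    · subst hx
      rw [he]
      have : ζ * B (Sum.inr c.2) (Sum.inl c.1) = 0 := by rw [hfe, mul_zero]
      simp only [hB] at this
      rw [this, add_zero]
      exact h.row_diag _
    · rw [hne x hx]
      exact h.row_diag x
  · intro x z hxz
    rw [pipes_succ_of_notMem hc]
    by_cases hx : x = Sum.inl c.1
    · subst hx
      rw [he]
      change B _ z + ζ * B _ z = 0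
      by_cases hz : z = Sum.inr c.2
      · subst hz
        simp only [ζ]
        field_simp
        ring
      · have h1 : Before (cellIndex c) (Sum.inl c.1) z := before_succ_of_ne hxz (by simp [hz])
        have h2 := (before_succ_iff c _ _).1 hxz
        rw [Equiv.swap_apply_left, Equiv.swap_apply_of_ne_of_ne hxz.ne.symm hz] at h2
        have h3 : B (Sum.inl c.1) z = 0 := h.row_tri _ _ h1
        have h4 : B (Sum.inr c.2) z = 0 := h.row_tri _ _ h2
        rw [h3, h4, mul_zero, add_zero]
    · rw [hne x hx]
      exact h.row_tri _ _ (before_succ_of_ne hxz (by simp [hx]))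

/-- Reading a cell `c` of `T`: its entry becomes `y c / X`, where `X` is a new indeterminate. -/
theorem IsGenericAt.succ_of_mem {K : Type*} [Field K] {n : ℕ} {T : Set (Fin n × Fin n)}
    {F : Type*} [Field F] [Algebra K F] {y : Fin n × Fin n → F} {Z : Fin n → Fin n → F}
    {Y : Fin n ⊕ Fin n → Fin n ⊕ Fin n → F} {c : Fin n × Fin n}
    (h : IsGenericAt K T (cellIndex c) y Z Y) (hc : c ∈ T) :
    ∃ (y' : Fin n × Fin n → RatFunc F) (Z' : Fin n → Fin n → RatFunc F)
      (Y' : Fin n ⊕ Fin n → Fin n ⊕ Fin n → RatFunc F),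
      IsGenericAt K T (cellIndex c + 1) y' Z' Y' := by
  classical
  obtain ⟨i, j⟩ := c
  set e : Fin n ⊕ Fin n := Sum.inl i with he
  set f : Fin n ⊕ Fin n := Sum.inr j with hf
  set ι : F →+* RatFunc F := (algebraMap (Polynomial F) (RatFunc F)).comp Polynomial.C with hι
  have hinj : Function.Injective ι :=
    (RatFunc.algebraMap_injective F).comp Polynomial.C_injective
  have hy0 : y (i, j) ≠ 0 := by
    have := h.indep.ne_zero ⟨(i, j), Or.inl hc⟩
    exact this
  have hιy : ι (y (i, j)) ≠ 0 := by rwa [Ne, map_eq_zero_iff ι hinj]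
  have hX : (RatFunc.X : RatFunc F) ≠ 0 := RatFunc.X_ne_zero
  -- `τ = -1 / z` is chosen so that the row `i` becomes `z` times the row of the column strand `j`;
  -- the other changes to `Z` and `Y` keep the remaining rows as they are
  set z : RatFunc F := ι (y (i, j)) / RatFunc.X with hz
  set τ : RatFunc F := - RatFunc.X / ι (y (i, j)) with hτ
  have hzτ : z * τ = -1 := by rw [hz, hτ]; field_simp
  have hz0 : z ≠ 0 := div_ne_zero hιy hX
  set A := shearRow Z Y with hA
  have hcol : ∀ a, i ≤ a → Z a j = 0 := fun a ha => h.eq_zero (a, j) (by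
    rw [← not_lt, cellIndex_lt_iff]; simp only; omega)
  have hrow : ∀ b, j ≤ b → Z i b = 0 := fun b hb => h.eq_zero (i, b) (by
    rw [← not_lt, cellIndex_lt_iff]; simp only; omega)
  let Z' : Fin n → Fin n → RatFunc F := fun a b =>
    ι (Z a b) - τ * ι (Z a j) * ι (Z i b) + if a = i ∧ b = j then z else 0
  let Y' : Fin n ⊕ Fin n → Fin n ⊕ Fin n → RatFunc F := fun x d => match x with
    | Sum.inl a => ι (Y (Sum.inl a) d) - τ * ι (Z a j) * ι (Y e d)
    | Sum.inr b => ι (Y (Sum.inr b) d) + if b = j then τ * ι (A e d) else 0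
  let y' : Fin n × Fin n → RatFunc F := fun d =>
    if d ∈ T ∧ cellIndex d < cellIndex (i, j) + 1 then Z' d.1 d.2 else ι (y d)
  have hAe : ∀ d, A e d = Y e d + ∑ b, Z i b * Y (Sum.inr b) d := fun d => rfl
  have hAf : ∀ d, A f d = Y f d := fun d => rfl
  have hAe0 : ∀ b, j ≤ b → A e (Sum.inr b) = 0 := fun b hb => by
    rw [hAe, h.tri (Sum.inr b) e (Nat.zero_le _), zero_add]
    refine Finset.sum_eq_zero fun b' _ => ?_
    rcases le_or_gt j b' with hb' | hb'
    · rw [hrow b' hb', zero_mul]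
    · rw [h.tri (Sum.inr b) (Sum.inr b') (lt_of_lt_of_le hb' hb), mul_zero]
  have hA' : ∀ x d, shearRow Z' Y' x d = if x = e then z * ι (A f d) else
      if x = f then ι (A f d) + τ * ι (A e d) else ι (A x d) := by
    intro x d
    rcases x with a | b
    · have h1 : ∑ b, Z' a b * Y' (Sum.inr b) d = ι (∑ b, Z a b * Y (Sum.inr b) d)
          - τ * ι (Z a j) * ι (∑ b, Z i b * Y (Sum.inr b) d)
          + (if a = i then z * ι (Y f d) else 0) + Z' a j * (τ * ι (A e d)) := by
        simp only [Y', mul_add, Finset.sum_add_distrib, mul_ite, mul_zero, Finset.sum_ite_eq',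
          Finset.mem_univ, if_true]
        congr 1
        simp only [Z', add_mul, sub_mul, Finset.sum_add_distrib, Finset.sum_sub_distrib, map_sum,
          map_mul, Finset.mul_sum, mul_assoc]
        congr 1
        by_cases ha : a = i <;> simp [ha, hf]
      have h2 : Z' a j = ι (Z a j) + if a = i then z else 0 := by
        simp only [Z', hrow j le_rfl, map_zero, mul_zero, sub_zero, and_true]
      simp only [shearRow]
      rw [h1, h2]
      by_cases ha : a = i
      · subst ha
        rw [if_pos rfl, if_pos rfl, if_pos rfl]
        simp only [Y', hcol a le_rfl, map_zero, hAf]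
        rw [hAe, map_add]
        linear_combination (ι (Y e d) + ι (∑ b, Z a b * Y (Sum.inr b) d)) * hzτ
      · have h3 : (Sum.inl a : Fin n ⊕ Fin n) ≠ e := fun h => ha (Sum.inl.inj h)
        rw [if_neg ha, if_neg ha, if_neg h3, if_neg (by simp [hf])]
        simp only [Y', hA, shearRow, he, map_add]
        ring
    · rw [if_neg (by simp [he])]
      simp only [shearRow, Y', hf, Sum.inr.injEq]
      by_cases hb : b = j
      · simp [hb, hA, shearRow]
      · simp [hb, hA, shearRow]
  have hfe : A f (pipes T (cellIndex (i, j)) e) = 0 := h.row_tri _ _ (le_refl (cellIndex (i, j)))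
  refine ⟨y', Z', Y', ?_, ?_, ?_, ?_, ?_, ?_, ?_⟩
  · refine algebraicIndepOn_of_eval_zero (F := F) (fun d => if d = (i, j) then 1 else 0)
      (fun d => if d = (i, j) then Polynomial.C (y (i, j)) else
        if d ∈ T ∧ cellIndex d < cellIndex (i, j) + 1 then Polynomial.C (Z d.1 d.2) +
          Polynomial.C (Z d.1 j * Z i d.2 / y (i, j)) * Polynomial.X else Polynomial.C (y d))
      _ ?_ ?_
    · intro d _
      by_cases hd : d = (i, j)
      · subst hd
        simp only [y', Z', hc, Nat.lt_succ_self, and_self, if_true, pow_one, hcol i le_rfl]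
        simp only [map_zero, mul_zero, sub_zero, zero_add, hz]
        rw [div_mul_cancel₀ _ hX]
        rfl
      · simp only [hd, if_false, pow_zero, mul_one, y']
        split_ifs with h1
        · have : ¬ (d.1 = i ∧ d.2 = j) := fun h => hd (Prod.ext h.1 h.2)
          have h2 : ∀ a : F, algebraMap (Polynomial F) (RatFunc F) (Polynomial.C a) = ι a :=
            fun _ => rfl
          simp only [Z', this, if_false, map_add, map_mul, h2, map_div₀, RatFunc.algebraMap_X, hτ]
          field_simp
          ring
        · rfl
    · have key : AlgebraicIndepOn K y {d | d ∈ T ∨ cellIndex (i, j) + 1 ≤ cellIndex d} := by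
        refine h.indep.mono ?_
        rintro d (hd | hd)
        · exact Or.inl hd
        · exact Or.inr (by omega)
      refine Eq.mp (congrArg (fun g : {d | d ∈ T ∨ cellIndex (i, j) + 1 ≤ cellIndex d} → F =>
        AlgebraicIndependent K g) (funext fun d => ?_)) key
      beta_reduce
      split_ifs with h1 h2
      · rw [h1, Polynomial.eval_C]
      · have := mt (@cellIndex_injective n d (i, j)) h1
        rw [Polynomial.eval_add, Polynomial.eval_mul, Polynomial.eval_X, mul_zero, add_zero,
          Polynomial.eval_C, h.eq_of_mem _ h2.1 (by omega)]
      · rw [Polynomial.eval_C]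
  · intro d hd hdr
    simp only [y', hd, hdr, and_self, if_true]
  · intro d hd
    have h1 := h.eq_zero d (by omega)
    have hdc : ¬ (d.1 = i ∧ d.2 = j) := by
      rintro ⟨h1, h2⟩
      rw [show d = (i, j) from Prod.ext h1 h2] at hd
      omega
    simp only [Z', hdc, if_false, h1, map_zero, zero_sub, add_zero, neg_eq_zero]
    have h2 : ¬ cellIndex d < cellIndex (i, j) := by omega
    rw [cellIndex_lt_iff] at h2
    simp only at h2
    rcases le_or_gt i d.1 with h3 | h3
    · rw [hcol _ h3]; simp
    · rw [hrow _ (by omega)]; simp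
  · rintro (a | b)
    · have : Z a j * Y e (Sum.inl a) = 0 := by
        rcases le_or_gt i a with ha | ha
        · rw [hcol a ha, zero_mul]
        · rw [h.tri (Sum.inl a) e ha, mul_zero]
      simp only [Y', h.diag, mul_assoc, ← map_mul, this, map_zero, mul_zero, sub_zero, map_one]
    · by_cases hb : b = j
      · simp [Y', h.diag, hb, hAe0 j le_rfl]
      · simp [Y', h.diag, hb]
  · rintro d (a | b) hd
    · have : Z a j * Y e d = 0 := by
        rcases le_or_gt i a with ha | ha
        · rw [hcol a ha, zero_mul]
        · rw [h.tri d e, mul_zero]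
          rcases d with a' | b'
          · exact lt_trans hd ha
          · exact Nat.zero_le _
      simp only [Y', h.tri _ _ hd, mul_assoc, ← map_mul, this, map_zero, mul_zero, sub_zero]
    · rcases d with a' | b'
      · exact absurd hd (Nat.not_lt_zero _)
      · simp only [Y', h.tri _ _ hd, map_zero, zero_add, ite_eq_right_iff]
        rintro rfl
        rw [hAe0 b' (le_of_lt hd), map_zero, mul_zero]
  · intro x
    rw [pipes_succ_of_mem hc, hA', Equiv.Perm.mul_apply]
    by_cases hxe : x = e
    · subst hxe
      rw [if_pos rfl, Equiv.swap_apply_left]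
      exact mul_ne_zero hz0 ((map_ne_zero_iff ι hinj).2 (h.row_diag f))
    · rw [if_neg hxe]
      by_cases hxf : x = f
      · subst hxf
        rw [if_pos rfl, Equiv.swap_apply_right, hfe, map_zero, zero_add]
        exact mul_ne_zero (by rw [hτ]; exact div_ne_zero (neg_ne_zero.2 hX) hιy)
          ((map_ne_zero_iff ι hinj).2 (h.row_diag e))
      · rw [if_neg hxf, Equiv.swap_apply_of_ne_of_ne hxe hxf]
        exact (map_ne_zero_iff ι hinj).2 (h.row_diag x)
  · intro x w hxw
    have h1 := (before_succ_iff (i, j) _ _).1 hxw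
    rw [pipes_succ_of_mem hc, hA', Equiv.Perm.mul_apply]
    by_cases hxe : x = e
    · subst hxe
      rw [Equiv.swap_apply_left] at h1
      rw [if_pos rfl, hA, h.row_tri f _ h1, map_zero, mul_zero]
    · rw [if_neg hxe]
      by_cases hxf : x = f
      · subst hxf
        have h2 := before_succ_of_ne hxw (by simp [hf])
        have hwe : w ≠ e := by
          rintro rfl
          exact Nat.not_succ_le_self _ hxw
        rw [Equiv.swap_apply_right] at h1
        rw [Equiv.swap_apply_of_ne_of_ne hwe hxw.ne.symm] at h1 ⊢
        rw [if_pos rfl, hA, h.row_tri _ _ h1, h.row_tri _ _ h2]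
        simp
      · rw [Equiv.swap_apply_of_ne_of_ne hxe hxf] at h1
        rw [if_neg hxf, hA, h.row_tri _ _ h1, map_zero]

universe u

theorem exists_isGenericAt (K : Type u) [Field K] {n : ℕ} (T : Set (Fin n × Fin n)) {r : ℕ}
    (hr : r ≤ n * n) : ∃ (F : Type u) (_ : Field F) (_ : Algebra K F) (y : Fin n × Fin n → F)
      (Z : Fin n → Fin n → F) (Y : Fin n ⊕ Fin n → Fin n ⊕ Fin n → F),
      IsGenericAt K T r y Z Y := by
  induction r with
  | zero =>
    let R := MvPolynomial (ULift.{u} (Fin n × Fin n)) K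
    refine ⟨FractionRing R, inferInstance, inferInstance,
      fun c => algebraMap R (FractionRing R) (MvPolynomial.X ⟨c⟩), _, _, IsGenericAt.zero K T ?_⟩
    have h1 : AlgebraicIndependent K (fun c : Fin n × Fin n => (MvPolynomial.X ⟨c⟩ : R)) :=
      (MvPolynomial.algebraicIndependent_X (ULift.{u} (Fin n × Fin n)) K).comp ULift.up
        ULift.up_injective
    exact h1.map' (f := IsScalarTower.toAlgHom K R (FractionRing R))
      (IsFractionRing.injective R (FractionRing R))
  | succ r ih =>
    obtain ⟨F, _, _, y, Z, Y, h⟩ := ih (by omega)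
    obtain ⟨c, rfl⟩ := exists_cellIndex_eq (n := n) (r := r) (by omega)
    by_cases hc : c ∈ T
    · obtain ⟨y', Z', Y', h'⟩ := h.succ_of_mem hc
      exact ⟨RatFunc F, inferInstance, inferInstance, y', Z', Y', h'⟩
    · obtain ⟨Z', h'⟩ := h.succ_of_notMem hc
      exact ⟨F, inferInstance, inferInstance, y, Z', Y, h'⟩

/-- A column whose final label does not lie on a row strand above the diagonal is, above the
diagonal, a combination of the columns to its right. -/
theorem IsGenericAt.eq_sum_Ioi {K : Type*} [Field K] {n : ℕ} {T : Set (Fin n × Fin n)}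
    {F : Type*} [Field F] [Algebra K F] {y : Fin n × Fin n → F} {Z : Fin n → Fin n → F}
    {Y : Fin n ⊕ Fin n → Fin n ⊕ Fin n → F} (h : IsGenericAt K T (n * n) y Z Y) {j : Fin n}
    (hj : ∀ i < j, pipes T (n * n) (Sum.inl i) ≠ Sum.inr j) {i : Fin n} (hi : i < j) :
    Z i j = ∑ j' ∈ Finset.Ioi j, -Y (Sum.inr j') (Sum.inr j) * Z i j' := by
  obtain ⟨x, hx⟩ := (pipes T (n * n)).surjective (Sum.inr j)
  have hbefore : Before (n * n) (Sum.inl i) x := by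
    rcases x with a | b
    · have : ¬ a < j := fun ha => hj a ha hx
      exact lt_of_lt_of_le hi (not_lt.1 this)
    · exact cellIndex_lt _
  have h1 := h.row_tri _ _ hbefore
  rw [hx, shearRow, h.tri (Sum.inr j) (Sum.inl i) (Nat.zero_le _), zero_add,
    ← Finset.sum_subset (Finset.subset_univ (Finset.Ici j)), ← Finset.Ioi_insert,
    Finset.sum_insert (by simp), h.diag] at h1
  · rw [mul_one] at h1
    rw [eq_neg_of_add_eq_zero_left h1, ← Finset.sum_neg_distrib]
    exact Finset.sum_congr rfl fun _ _ => by ring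
  · intro b _ hb
    rw [Finset.mem_Ici, not_le] at hb
    rw [h.tri (Sum.inr j) (Sum.inr b) hb, mul_zero]

/-- If at most `k` labels of the pipe dream of `T` leave above the diagonal, there is a matrix of
rank at most `k` whose entries in the cells of `T` above the diagonal are algebraically
independent. -/
theorem exists_algebraicIndepOn_sum_mul (K : Type u) [Field K] {k n : ℕ}
    (T : Set (Fin n × Fin n))
    (hT : {j | ∃ i < j, pipes T (n * n) (Sum.inl i) = Sum.inr j}.ncard ≤ k) :
    ∃ (F : Type u) (_ : Field F) (_ : Algebra K F) (a b : Fin k → Fin n → F),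
      AlgebraicIndepOn K (fun c : Fin n × Fin n => ∑ l, a l c.1 * b l c.2)
        {c | c ∈ T ∧ c.1 < c.2} := by
  classical
  obtain ⟨F, _, _, y, Z, Y, h⟩ := exists_isGenericAt K T (le_refl (n * n))
  set E := {j | ∃ i < j, pipes T (n * n) (Sum.inl i) = Sum.inr j} with hE
  have hind : AlgebraicIndepOn K y {c | c ∈ T ∧ c.1 < c.2} := h.indep.mono fun c hc => Or.inl hc.1
  obtain ⟨p, hp⟩ : ∃ p : E → Fin k, Function.Injective p := by
    have h1 : Fintype.card E ≤ Fintype.card (Fin k) := by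
      rwa [Fintype.card_eq_nat_card, Nat.card_coe_set_eq, Fintype.card_fin]
    obtain ⟨p⟩ := Function.Embedding.nonempty_of_card_le h1
    exact ⟨p, p.injective⟩
  -- the columns in `E` span all columns above the diagonal, by induction from right to left
  have hcol : ∀ m : ℕ, ∀ j : Fin n, n - j ≤ m → ∃ w : E → F,
      ∀ i < j, Z i j = ∑ e : E, Z i e * w e := by
    intro m
    induction m with
    | zero => intro j hj; omega
    | succ m ih =>
      intro j hjm
      by_cases hj : j ∈ E
      · refine ⟨Pi.single ⟨j, hj⟩ 1, fun i _ => ?_⟩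
        simp [Pi.single_apply]
      · have hj' : ∀ i < j, pipes T (n * n) (Sum.inl i) ≠ Sum.inr j :=
          fun i hi h => hj ⟨i, hi, h⟩
        have : ∀ j' : Fin n, ∃ w : E → F, j < j' → ∀ i < j', Z i j' = ∑ e : E, Z i e * w e := by
          intro j'
          by_cases h' : j < j'
          · obtain ⟨w, hw⟩ := ih j' (by omega)
            exact ⟨w, fun _ => hw⟩
          · exact ⟨0, fun h => absurd h h'⟩
        choose w hw using this
        refine ⟨fun e => ∑ j' ∈ Finset.Ioi j, -Y (Sum.inr j') (Sum.inr j) * w j' e,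
          fun i hi => ?_⟩
        rw [h.eq_sum_Ioi hj' hi]
        simp only [Finset.mul_sum]
        rw [Finset.sum_comm]
        refine Finset.sum_congr rfl fun j' hj' => ?_
        rw [Finset.mem_Ioi] at hj'
        rw [hw j' hj' i (hi.trans hj'), Finset.mul_sum]
        exact Finset.sum_congr rfl fun e _ => by ring
  have hcol' := fun j : Fin n => hcol (n - j) j le_rfl
  choose w hw using hcol'
  refine ⟨F, inferInstance, inferInstance, fun l i => Function.extend p (fun e => Z i e) 0 l,
    fun l j => Function.extend p (w j) 0 l, ?_⟩
  refine Eq.mp (congrArg (fun g : {c | c ∈ T ∧ c.1 < c.2} → F => AlgebraicIndependent K g)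
    (funext fun c => ?_)) hind
  rw [← h.eq_of_mem c.1 c.2.1 (cellIndex_lt _), hw c.1.2 c.1.1 c.2.2]
  refine Fintype.sum_of_injective p hp _ _ (fun l hl => ?_) (fun e => ?_) <;> beta_reduce
  · rw [Function.extend_apply', Pi.zero_apply, zero_mul]
    exact fun ⟨e, he⟩ => hl ⟨e, he⟩
  · rw [hp.extend_apply, hp.extend_apply]

/-- The cells of the `n × n` square that belong to `T`, where an edge `{i, j}` with `i < j` is
identified with the cell `(i, j)`, together with all cells on or below the diagonal. -/
def upperCells {n : ℕ} (T : Set (Edge n)) : Set (Fin n × Fin n) :=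
  {c | ∀ h : c.1 < c.2, (⟨c, h⟩ : Edge n) ∈ T}

theorem indep_skewMatroid_of_sum_wedge {K : Type*} [Field K] {k n : ℕ} {L : Type*} [Field L]
    [Algebra K L] (a b : Fin k → Fin n → L) {T : Set (Edge n)}
    (h : AlgebraicIndepOn K (fun e => ∑ l, wedge (a l) (b l) e) T) :
    (skewMatroid K k n).Indep T :=
  skewMatroid_indep_iff.2 fun f hS hf =>
    (algebraicIndependent_comp_subtype (x := fun e => ∑ l, wedge (a l) (b l) e)).1 h f hS
      (aeval_sum_wedge_eq_zero hf a b)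

/-- The antisymmetric matrix degenerates to the upper triangle of a matrix of rank at most `k` when
the rows of the latter are scaled by `t ^ i` and its columns by `t ^ (-j)`. -/
theorem indep_skewMatroid_of_pipes (K : Type u) [Field K] {k n : ℕ} (T : Set (Edge n))
    (hT : {j | ∃ i < j, pipes (upperCells T) (n * n) (Sum.inl i) = Sum.inr j}.ncard ≤ k) :
    (skewMatroid K k n).Indep T := by
  classical
  obtain ⟨F, _, _, a, b, hind⟩ := exists_algebraicIndepOn_sum_mul K (upperCells T) hT
  set ι : F →+* RatFunc F := (algebraMap (Polynomial F) (RatFunc F)).comp Polynomial.C with hι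
  have hX : (RatFunc.X : RatFunc F) ≠ 0 := RatFunc.X_ne_zero
  -- after multiplication by `X ^ (hi - lo)`, the transposed terms have a positive power of `X`
  let a' : Fin k → Fin n → RatFunc F := fun l i => RatFunc.X ^ (i : ℕ) * ι (a l i)
  let b' : Fin k → Fin n → RatFunc F := fun l i => ι (b l i) / RatFunc.X ^ (i : ℕ)
  have hx : AlgebraicIndepOn K (fun e => ∑ l, wedge (a' l) (b' l) e) T := by
    refine algebraicIndepOn_of_eval_zero (F := F) (fun e => e.hi - e.lo)
      (fun e => ∑ l, (Polynomial.C (a l e.lo * b l e.hi) -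
        Polynomial.C (a l e.hi * b l e.lo) * Polynomial.X ^ (2 * (e.hi - e.lo : ℕ)))) _ ?_ ?_
    · intro e _
      have h2 : ∀ a : F, algebraMap (Polynomial F) (RatFunc F) (Polynomial.C a) = ι a :=
        fun _ => rfl
      rw [map_sum, Finset.sum_mul]
      refine Finset.sum_congr rfl fun l _ => ?_
      obtain ⟨d, hd⟩ : ∃ d, (e.hi : ℕ) = e.lo + d := ⟨e.hi - e.lo, by have := e.lo_lt_hi; omega⟩
      simp only [a', b', wedge, map_sub, map_mul, h2, map_pow, RatFunc.algebraMap_X, hd,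
        Nat.add_sub_cancel_left]
      field_simp
      ring
    · let q : T → {c | c ∈ upperCells T ∧ c.1 < c.2} :=
        fun e => ⟨e.1.1, fun _ => e.2, e.1.lo_lt_hi⟩
      have hq : Function.Injective q := by
        intro e f h
        have h3 : (q e).1 = (q f).1 := congrArg _ h
        exact Subtype.ext (Subtype.ext h3)
      have h1 := hind.comp q hq
      refine Eq.mp (congrArg (fun g : T → F => AlgebraicIndependent K g) (funext fun e => ?_)) h1
      have h3 : 2 * (e.1.hi - e.1.lo : ℕ) ≠ 0 := by have := e.1.lo_lt_hi; omega
      simp only [Polynomial.eval_finsetSum, Polynomial.eval_sub, Polynomial.eval_mul,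
        Polynomial.eval_C, Polynomial.eval_pow, Polynomial.eval_X, zero_pow h3, mul_zero, sub_zero]
      rfl
  exact indep_skewMatroid_of_sum_wedge a' b' hx

/-! ### The labels on the strands -/

/-- The column a label started in, counted from one, or zero if it started in a row. -/
def columnNumber {n : ℕ} : Fin n ⊕ Fin n → ℕ
  | Sum.inl _ => 0
  | Sum.inr j => j + 1

/-- The number of the label with which the row `i` enters the column `j`. -/
noncomputable def rowLabel {n : ℕ} (T : Set (Fin n × Fin n)) (i : Fin n) (j : ℕ) : ℕ :=
  columnNumber (pipes T (i * n + j) (Sum.inl i))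

/-- The number of the label with which the column `j` enters the row `i`. -/
noncomputable def colLabel {n : ℕ} (T : Set (Fin n × Fin n)) (i : ℕ) (j : Fin n) : ℕ :=
  columnNumber (pipes T (i * n) (Sum.inr j))

theorem pipes_apply_eq {n : ℕ} (T : Set (Fin n × Fin n)) {r s : ℕ} (hrs : r ≤ s)
    (hs : s ≤ n * n) {x : Fin n ⊕ Fin n} (h : ∀ c : Fin n × Fin n, r ≤ cellIndex c →
      cellIndex c < s → x ≠ Sum.inl c.1 ∧ x ≠ Sum.inr c.2) : pipes T s x = pipes T r x := by
  induction s, hrs using Nat.le_induction with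
  | base => rfl
  | succ s hrs ih =>
    rw [← ih (by omega) fun c h1 h2 => h c h1 (by omega)]
    obtain ⟨c, rfl⟩ := exists_cellIndex_eq (n := n) (r := s) (by omega)
    by_cases hc : c ∈ T
    · obtain ⟨h1, h2⟩ := h c hrs (by omega)
      rw [pipes_succ_of_mem hc, Equiv.Perm.mul_apply, Equiv.swap_apply_of_ne_of_ne h1 h2]
    · rw [pipes_succ_of_notMem hc]

theorem row_mul_le_cellIndex_iff {n : ℕ} (i : ℕ) (c : Fin n × Fin n) :
    i * n ≤ cellIndex c ↔ i ≤ c.1 := by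
  have h2 := c.2.2
  unfold cellIndex
  constructor
  · intro h
    by_contra h3
    have : (c.1.1 + 1) * n ≤ i * n := Nat.mul_le_mul_right _ (by omega)
    rw [Nat.add_mul, one_mul] at this
    omega
  · intro h
    have : i * n ≤ c.1 * n := Nat.mul_le_mul_right _ h
    omega

theorem pipes_cellIndex_inr {n : ℕ} (T : Set (Fin n × Fin n)) (c : Fin n × Fin n) :
    pipes T (cellIndex c) (Sum.inr c.2) = pipes T (c.1 * n) (Sum.inr c.2) := by
  refine pipes_apply_eq T ((row_mul_le_cellIndex_iff _ c).2 le_rfl) (cellIndex_lt c).le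
    fun d h1 h2 => ⟨by simp, ?_⟩
  rw [row_mul_le_cellIndex_iff] at h1
  rw [cellIndex_lt_iff] at h2
  rw [Ne, Sum.inr.injEq]
  omega

theorem pipes_succ_cellIndex_inr {n : ℕ} (T : Set (Fin n × Fin n)) (c : Fin n × Fin n) :
    pipes T ((c.1 + 1 : ℕ) * n) (Sum.inr c.2) = pipes T (cellIndex c + 1) (Sum.inr c.2) := by
  have h3 := row_mul_le_cellIndex_iff (c.1 + 1) c
  refine pipes_apply_eq T (r := cellIndex c + 1) (s := (c.1 + 1 : ℕ) * n) (by omega)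
    (Nat.mul_le_mul_right _ c.1.2)
    fun d h1 h2 => ⟨by simp, ?_⟩
  have h4 := row_mul_le_cellIndex_iff (c.1 + 1) d
  have h5 := cellIndex_lt_iff c d
  rw [Ne, Sum.inr.injEq]
  omega

@[simp]
theorem rowLabel_zero {n : ℕ} (T : Set (Fin n × Fin n)) (i : Fin n) : rowLabel T i 0 = 0 := by
  rw [rowLabel, Nat.add_zero, pipes_apply_eq T (Nat.zero_le _)
    (Nat.mul_le_mul_right _ i.2.le) fun c _ h2 => ⟨?_, by simp⟩]
  · rfl
  · have := row_mul_le_cellIndex_iff i c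
    rw [Ne, Sum.inl.injEq]
    omega

@[simp]
theorem colLabel_zero {n : ℕ} (T : Set (Fin n × Fin n)) (j : Fin n) :
    colLabel T 0 j = j + 1 := by
  rw [colLabel, Nat.zero_mul]
  rfl

theorem rowLabel_top {n : ℕ} (T : Set (Fin n × Fin n)) (i : Fin n) :
    rowLabel T i n = columnNumber (pipes T (n * n) (Sum.inl i)) := by
  have h : (i * n + n : ℕ) = (i + 1 : ℕ) * n := by ring
  rw [rowLabel, h, pipes_apply_eq T (r := (i + 1 : ℕ) * n) (s := n * n)
    (Nat.mul_le_mul_right _ i.2) le_rfl fun c h1 h2 => ⟨?_, by simp⟩]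
  have := row_mul_le_cellIndex_iff (i + 1) c
  rw [Ne, Sum.inl.injEq]
  omega

theorem rowLabel_succ_of_mem {n : ℕ} {T : Set (Fin n × Fin n)} {i j : Fin n} (h : (i, j) ∈ T) :
    rowLabel T i (j + 1) = colLabel T i j := by
  have h1 := pipes_succ_of_mem h
  have h2 := pipes_cellIndex_inr T (i, j)
  rw [colLabel, ← h2, rowLabel, ← add_assoc]
  change columnNumber (pipes T (cellIndex (i, j) + 1) _) = _
  rw [h1, Equiv.Perm.mul_apply, Equiv.swap_apply_left]

theorem colLabel_succ_of_mem {n : ℕ} {T : Set (Fin n × Fin n)} {i j : Fin n} (h : (i, j) ∈ T) :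
    colLabel T (i + 1) j = rowLabel T i j := by
  have h1 := pipes_succ_of_mem h
  have h2 := pipes_succ_cellIndex_inr T (i, j)
  rw [colLabel, h2, h1, Equiv.Perm.mul_apply, Equiv.swap_apply_right]
  rfl

theorem rowLabel_succ_of_notMem {n : ℕ} {T : Set (Fin n × Fin n)} {i j : Fin n}
    (h : (i, j) ∉ T) : rowLabel T i (j + 1) = rowLabel T i j := by
  have h1 := pipes_succ_of_notMem h
  rw [rowLabel, ← add_assoc]
  change columnNumber (pipes T (cellIndex (i, j) + 1) _) = _
  rw [h1]
  rfl

theorem colLabel_succ_of_notMem {n : ℕ} {T : Set (Fin n × Fin n)} {i j : Fin n}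
    (h : (i, j) ∉ T) : colLabel T (i + 1) j = colLabel T i j := by
  have h1 := pipes_succ_of_notMem h
  have h2 := pipes_succ_cellIndex_inr T (i, j)
  have h3 := pipes_cellIndex_inr T (i, j)
  rw [colLabel, h2, h1, h3]
  rfl

theorem rowLabel_cellIndex {n : ℕ} (T : Set (Fin n × Fin n)) (c : Fin n × Fin n) :
    columnNumber (pipes T (cellIndex c) (Sum.inl c.1)) = rowLabel T c.1 c.2 := rfl

theorem colLabel_cellIndex {n : ℕ} (T : Set (Fin n × Fin n)) (c : Fin n × Fin n) :
    columnNumber (pipes T (cellIndex c) (Sum.inr c.2)) = colLabel T c.1 c.2 := by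
  rw [pipes_cellIndex_inr, colLabel]

theorem colLabel_le_and_rowLabel_le {n : ℕ} (T : Set (Fin n × Fin n)) (i : ℕ) :
    (i ≤ n → ∀ j : Fin n, colLabel T i j ≤ j + 1) ∧
      ∀ hi : i < n, ∀ j ≤ n, rowLabel T ⟨i, hi⟩ j ≤ j := by
  have key : ∀ i : Fin n, (∀ j : Fin n, colLabel T i j ≤ j + 1) →
      ∀ j ≤ n, rowLabel T i j ≤ j := by
    intro i h j
    induction j with
    | zero => simp
    | succ j ih =>
      intro hj
      by_cases hc : (i, (⟨j, hj⟩ : Fin n)) ∈ T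
      · have h1 := rowLabel_succ_of_mem hc
        have h2 := h ⟨j, hj⟩
        simp only at h1 h2
        omega
      · have h1 := rowLabel_succ_of_notMem hc
        have h2 := ih (by omega)
        simp only at h1
        omega
  induction i with
  | zero => exact ⟨fun _ j => by simp, fun hi => key ⟨0, hi⟩ fun j => by simp⟩
  | succ i ih =>
    have h1 : i + 1 ≤ n → ∀ j : Fin n, colLabel T (i + 1) j ≤ j + 1 := by
      intro hi j
      by_cases hc : ((⟨i, hi⟩ : Fin n), j) ∈ T
      · have h1 := colLabel_succ_of_mem hc
        have h2 := ih.2 hi j j.2.le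
        simp only at h1
        omega
      · have h1 := colLabel_succ_of_notMem hc
        have h2 := ih.1 (by omega) j
        simp only at h1
        omega
    exact ⟨h1, fun hi => key ⟨i + 1, hi⟩ (h1 hi.le)⟩

theorem rowLabel_le {n : ℕ} (T : Set (Fin n × Fin n)) (i : Fin n) {j : ℕ} (hj : j ≤ n) :
    rowLabel T i j ≤ j :=
  (colLabel_le_and_rowLabel_le T i).2 i.2 j hj

theorem mem_upperCells_of_le {n : ℕ} (T : Set (Edge n)) {i j : Fin n} (h : j ≤ i) :
    (i, j) ∈ upperCells T := fun h' => absurd h (not_le.2 h')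

/-- The labels of the rows turn downwards in the cells of the diagonal, so that none of them appears
above the diagonal. -/
theorem colLabel_pos_and_rowLabel_pos {n : ℕ} (T : Set (Edge n)) (i : ℕ) :
    (∀ j : Fin n, i ≤ j → 0 < colLabel (upperCells T) i j) ∧
      ∀ hi : i < n, ∀ j ≤ n, i < j → 0 < rowLabel (upperCells T) ⟨i, hi⟩ j := by
  have key : ∀ i : Fin n, (∀ j : Fin n, i ≤ j → 0 < colLabel (upperCells T) i j) →
      ∀ j ≤ n, i < j → 0 < rowLabel (upperCells T) i j := by
    intro i h j
    induction j with
    | zero => simp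
    | succ j ih =>
      intro hj hij
      by_cases hc : (i, (⟨j, hj⟩ : Fin n)) ∈ upperCells T
      · have h1 := rowLabel_succ_of_mem hc
        have h2 := h ⟨j, hj⟩ (by rw [Fin.le_def]; simp only; omega)
        simp only at h1
        omega
      · have h1 := rowLabel_succ_of_notMem hc
        have h3 : (i : ℕ) < j := by
          by_contra h3
          exact hc (mem_upperCells_of_le T (by rw [Fin.le_def]; simp only; omega))
        have h2 := ih (by omega) h3
        simp only at h1
        omega
  induction i with
  | zero => exact ⟨fun j _ => by simp, fun hi => key ⟨0, hi⟩ fun j _ => by simp⟩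
  | succ i ih =>
    have h1 : ∀ j : Fin n, i + 1 ≤ j → 0 < colLabel (upperCells T) (i + 1) j := by
      intro j hj
      have hi : i < n := by omega
      by_cases hc : ((⟨i, hi⟩ : Fin n), j) ∈ upperCells T
      · have h1 := colLabel_succ_of_mem hc
        have h2 := ih.2 hi j j.2.le (by omega)
        simp only at h1
        omega
      · have h1 := colLabel_succ_of_notMem hc
        have h2 := ih.1 j (by omega)
        simp only at h1
        omega
    exact ⟨h1, fun hi => key ⟨i + 1, hi⟩ h1⟩

theorem rowLabel_pos {n : ℕ} (T : Set (Edge n)) {i : Fin n} {j : ℕ} (hj : j ≤ n) (hij : i < j) :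
    0 < rowLabel (upperCells T) i j :=
  (colLabel_pos_and_rowLabel_pos T i).2 i.2 j hj hij

/-! ### Crossings and the number of labels -/

/-- The number of rows `a < i` that enter the column `j` with the label of a column `≥ q`. -/
noncomputable def labelCount {n : ℕ} (T : Set (Fin n × Fin n)) (q i j : ℕ) : ℕ :=
  (Finset.univ.filter fun a : Fin n => (a : ℕ) < i ∧ q < rowLabel T a j).card

theorem labelCount_zero {n : ℕ} (T : Set (Fin n × Fin n)) (q j : ℕ) : labelCount T q 0 j = 0 := by
  simp [labelCount]

theorem labelCount_self {n : ℕ} (T : Set (Fin n × Fin n)) {q : ℕ} (hq : q ≤ n) (i : ℕ) :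
    labelCount T q i q = 0 := by
  rw [labelCount, Finset.card_eq_zero, Finset.filter_eq_empty_iff]
  exact fun a _ h => absurd h.2 (not_lt.2 (rowLabel_le T a hq))

theorem labelCount_succ_left {n : ℕ} (T : Set (Fin n × Fin n)) (q : ℕ) (i : Fin n) (j : ℕ) :
    labelCount T q (i + 1) j = labelCount T q i j + if q < rowLabel T i j then 1 else 0 := by
  have h : (Finset.univ.filter fun a : Fin n => (a : ℕ) < i + 1 ∧ q < rowLabel T a j) =
      (Finset.univ.filter fun a : Fin n => (a : ℕ) < i ∧ q < rowLabel T a j) ∪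
        if q < rowLabel T i j then {i} else ∅ := by
    ext a
    by_cases ha : a = i
    · subst ha
      split_ifs with h <;> simp [h]
    · split_ifs <;> simp [ha] <;> omega
  rw [labelCount, h, Finset.card_union_of_disjoint]
  · split_ifs <;> simp [labelCount]
  · split_ifs <;> simp

/-- Each cell preserves the labels that pass through it, so that the labels of columns `≥ q` that
enter the column `j` from the left or from above leave it to the right or below. -/
theorem labelCount_succ_right {n : ℕ} (T : Set (Fin n × Fin n)) {q i : ℕ} (hi : i ≤ n)
    {j : Fin n} (hq : q ≤ j) :
    labelCount T q i (j + 1) + (if q < colLabel T i j then 1 else 0) = labelCount T q i j + 1 := by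
  induction i with
  | zero => simp [labelCount_zero, Nat.lt_succ_of_le hq]
  | succ i ih =>
    have h1 := labelCount_succ_left T q ⟨i, hi⟩ j
    have h2 := labelCount_succ_left T q ⟨i, hi⟩ (j + 1)
    have h3 := ih (by omega)
    simp only at h1 h2
    rw [h1, h2]
    by_cases hc : ((⟨i, hi⟩ : Fin n), j) ∈ T
    · have h4 := rowLabel_succ_of_mem hc
      have h5 := colLabel_succ_of_mem hc
      simp only at h4 h5
      rw [h4, h5]
      omega
    · have h4 := rowLabel_succ_of_notMem hc
      have h5 := colLabel_succ_of_notMem hc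
      simp only at h4 h5
      rw [h4, h5]
      omega

theorem labelCount_mono_left {n : ℕ} (T : Set (Fin n × Fin n)) (q j : ℕ) {i i' : ℕ}
    (h : i ≤ i') : labelCount T q i j ≤ labelCount T q i' j :=
  Finset.card_le_card (Finset.monotone_filter_right _ fun _ _ ha => ⟨lt_of_lt_of_le ha.1 h, ha.2⟩)

theorem labelCount_mono_right {n : ℕ} (T : Set (Fin n × Fin n)) {q i : ℕ} (hi : i ≤ n) {j j' : ℕ}
    (hq : q ≤ j) (h : j ≤ j') (hj : j' ≤ n) : labelCount T q i j ≤ labelCount T q i j' := by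
  induction j', h using Nat.le_induction with
  | base => rfl
  | succ j' h ih =>
    have := labelCount_succ_right T hi (j := ⟨j', hj⟩) (hq.trans h)
    have := ih (by omega)
    simp only at *
    split_ifs at * <;> omega

theorem labelCount_succ_succ_of_mem {n : ℕ} {T : Set (Fin n × Fin n)} {q : ℕ} {i j : Fin n}
    (h : (i, j) ∈ T) (hq : q ≤ j) : labelCount T q (i + 1) (j + 1) = labelCount T q i j + 1 := by
  rw [labelCount_succ_left, rowLabel_succ_of_mem h, labelCount_succ_right T i.2.le hq]

theorem labelCount_succ_succ_of_notMem {n : ℕ} {T : Set (Fin n × Fin n)} {q : ℕ} {i j : Fin n}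
    (h : (i, j) ∉ T) (hq : q ≤ j) (hlt : rowLabel T i j < colLabel T i j) :
    labelCount T q (i + 1) (j + 1) =
      max (labelCount T q i (j + 1)) (labelCount T q (i + 1) j) := by
  rw [labelCount_succ_left, rowLabel_succ_of_notMem h, labelCount_succ_left]
  have := labelCount_succ_right T i.2.le hq
  split_ifs at * <;> omega

theorem mem_upperCells_iff {n : ℕ} {T : Set (Edge n)} {e : Edge n} :
    (e.lo, e.hi) ∈ upperCells T ↔ e ∈ T :=
  ⟨fun h => h e.2, fun h _ => h⟩

theorem exists_edge_of_notMem_upperCells {n : ℕ} {T : Set (Edge n)} {c : Fin n × Fin n}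
    (hc : c ∉ upperCells T) : ∃ e : Edge n, e ∉ T ∧ (e.lo, e.hi) = c := by
  simp only [upperCells, Set.mem_ofPred_eq, not_forall] at hc
  obtain ⟨h, hc⟩ := hc
  exact ⟨⟨c, h⟩, hc, rfl⟩

theorem IsCrossingFree.card_le {k n : ℕ} {T : Set (Edge n)} (hT : IsCrossingFree (k + 1) T)
    {C : Finset (Edge n)} (hC : ∀ e ∈ C, ∀ f ∈ C, e ≠ f → e.Cross f)
    (hCT : (C : Set (Edge n)) ⊆ T) : C.card ≤ k := by
  by_contra h
  obtain ⟨D, hD, hcard⟩ := Finset.exists_subset_card_eq (Nat.succ_le_of_lt (not_le.1 h))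
  exact hT D ⟨hcard, fun e he f hf => hC e (hD he) f (hD hf)⟩
    (subset_trans (Finset.coe_subset.2 hD) hCT)

/-- Pairwise crossing edges are separated by a vertex, on one side of which are all their smaller
end-points and on the other side all their larger end-points. -/
theorem exists_separator {n : ℕ} {C : Finset (Edge n)} (h0 : C.Nonempty)
    (hC : ∀ e ∈ C, ∀ f ∈ C, e ≠ f → e.Cross f) :
    ∃ q ≤ n, ∀ e ∈ C, (e.lo : ℕ) < q ∧ q ≤ e.hi := by
  obtain ⟨e₀, he₀, hmax⟩ := C.exists_max_image (fun e => (e.lo : ℕ)) h0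
  refine ⟨e₀.lo + 1, e₀.lo.2, fun e he => ⟨Nat.lt_succ_of_le (hmax e he), ?_⟩⟩
  by_cases h : e = e₀
  · subst h
    exact e.lo_lt_hi
  · have := hmax e he
    rcases hC e he e₀ he₀ h with h1 | h1 <;> unfold Edge.CrossLeft at h1 <;> omega

/-- The edges of `T` in a crossing take each label at most once, so that their number is bounded by
the number of labels. -/
theorem card_le_labelCount {n : ℕ} {T : Set (Edge n)} {q i j : ℕ} (hiq : i ≤ q) (hqj : q ≤ j)
    (hj : j ≤ n) {C : Finset (Edge n)} (hC : ∀ e ∈ C, ∀ f ∈ C, e ≠ f → e.Cross f)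
    (hCT : (C : Set (Edge n)) ⊆ T) (h : ∀ e ∈ C, (e.lo : ℕ) < i ∧ q ≤ e.hi ∧ (e.hi : ℕ) < j) :
    C.card ≤ labelCount (upperCells T) q i j := by
  classical
  induction i generalizing C j with
  | zero =>
    rw [Finset.eq_empty_of_forall_notMem fun e he => Nat.not_lt_zero _ (h e he).1]
    exact Nat.zero_le _
  | succ i ih =>
    by_cases hc : ∃ c ∈ C, (c.lo : ℕ) = i
    · obtain ⟨c, hc, rfl⟩ := hc
      have h1 := ih (by omega) (h c hc).2.1 (c.hi.2.le) (C := C.erase c)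
        (fun e he f hf => hC e (Finset.mem_of_mem_erase he) f (Finset.mem_of_mem_erase hf))
        (fun e he => hCT (Finset.mem_of_mem_erase he)) (fun e he => by
          have h2 := hC e (Finset.mem_of_mem_erase he) c hc (Finset.ne_of_mem_erase he)
          have h3 := h e (Finset.mem_of_mem_erase he)
          rcases h2 with h2 | h2 <;> unfold Edge.CrossLeft at h2 <;> omega)
      rw [← Finset.card_erase_add_one hc]
      refine (Nat.add_le_add_right h1 1).trans ?_
      rw [← labelCount_succ_succ_of_mem (mem_upperCells_iff.2 (hCT hc)) (h c hc).2.1]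
      exact labelCount_mono_right _ (by omega) (by have := h c hc; omega) (h c hc).2.2 hj
    · refine (ih (by omega) hqj hj hC hCT fun e he => ?_).trans
        (labelCount_mono_left _ q j (Nat.le_succ i))
      have h1 := h e he
      have h2 : (e.lo : ℕ) ≠ i := fun h2 => hc ⟨e, he, h2⟩
      exact ⟨by omega, h1.2⟩

/-- The bound of `card_le_labelCount` is attained if, in every cell outside of `T`, the label that
goes through the row is smaller than the one that goes through the column. -/
theorem exists_card_eq_labelCount {n : ℕ} {T : Set (Edge n)} {q i j : ℕ} (hiq : i ≤ q)
    (hqj : q ≤ j) (hj : j ≤ n) (h : ∀ e : Edge n, (e.lo : ℕ) < i → (e.hi : ℕ) < j → e ∉ T →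
      rowLabel (upperCells T) e.lo e.hi < colLabel (upperCells T) e.lo e.hi) :
    ∃ C : Finset (Edge n), (∀ e ∈ C, ∀ f ∈ C, e ≠ f → e.Cross f) ∧ (C : Set (Edge n)) ⊆ T ∧
      (∀ e ∈ C, (e.lo : ℕ) < i ∧ q ≤ e.hi ∧ (e.hi : ℕ) < j) ∧
        C.card = labelCount (upperCells T) q i j := by
  classical
  induction i generalizing j with
  | zero => exact ⟨∅, by simp, by simp, by simp, by rw [labelCount_zero, Finset.card_empty]⟩
  | succ i ihi =>
    induction j, hqj using Nat.le_induction with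
    | base => exact ⟨∅, by simp, by simp, by simp, by rw [labelCount_self _ hj, Finset.card_empty]⟩
    | succ j hqj ihj =>
      let c : Edge n := ⟨(⟨i, by omega⟩, ⟨j, hj⟩), by rw [Fin.lt_def]; simp only; omega⟩
      have hclo : (c.lo : ℕ) = i := rfl
      have hchi : (c.hi : ℕ) = j := rfl
      by_cases hc : c ∈ T
      · obtain ⟨C, h1, h2, h3, h4⟩ := ihi (by omega) hqj (by omega)
          (fun e he he' => h e (by omega) (by omega))
        have hcC : c ∉ C := fun h => by have := h3 c h; omega
        have hcross : ∀ e ∈ C, e.CrossLeft c := fun e he => by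
          have := h3 e he
          unfold Edge.CrossLeft
          omega
        refine ⟨insert c C, ?_, ?_, ?_, ?_⟩
        · intro e he f hf hef
          rw [Finset.mem_insert] at he hf
          rcases he with rfl | he <;> rcases hf with rfl | hf
          · exact absurd rfl hef
          · exact Or.inr (hcross f hf)
          · exact Or.inl (hcross e he)
          · exact h1 e he f hf hef
        · rw [Finset.coe_insert]
          exact Set.insert_subset hc h2
        · intro e he
          rcases Finset.mem_insert.1 he with rfl | he
          · omega
          · have := h3 e he
            omega
        · rw [Finset.card_insert_of_notMem hcC, h4]
          exact (labelCount_succ_succ_of_mem (mem_upperCells_iff.2 hc) hqj).symm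
      · have hmax := labelCount_succ_succ_of_notMem (mt mem_upperCells_iff.1 hc) hqj
          (h c (by omega) (by omega) hc)
        rw [hclo, hchi] at hmax
        rw [hmax]
        rcases max_choice (labelCount (upperCells T) q i (j + 1))
          (labelCount (upperCells T) q (i + 1) j) with h5 | h5
        · obtain ⟨C, h1, h2, h3, h4⟩ := ihi (by omega) (hqj.trans (Nat.le_succ j)) hj
            (fun e he he' => h e (by omega) he')
          refine ⟨C, h1, h2, fun e he => ?_, by rw [h4, h5]⟩
          have := h3 e he
          omega
        · obtain ⟨C, h1, h2, h3, h4⟩ := ihj (by omega) (fun e he he' => h e he (by omega))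
          refine ⟨C, h1, h2, fun e he => ?_, by rw [h4, h5]⟩
          have := h3 e he
          omega

theorem isCrossingFree_of_labelCount_le {k n : ℕ} {T : Set (Edge n)}
    (h : ∀ q ≤ n, labelCount (upperCells T) q q n ≤ k) : IsCrossingFree (k + 1) T := by
  rintro C ⟨hcard, hC⟩ hCT
  obtain ⟨q, hq, hsep⟩ := exists_separator (Finset.card_pos.1 (by omega)) hC
  have h1 := card_le_labelCount le_rfl hq le_rfl hC hCT fun e he =>
    ⟨(hsep e he).1, (hsep e he).2, e.hi.2⟩
  have h2 := h q hq
  omega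

/-- In a `k`-triangulation, two labels that meet in a cell outside of `T` are in increasing order:
otherwise, any crossing that uses this cell could be replaced by one of at least the same size that
does not use it. -/
theorem IsKTriangulation.rowLabel_lt_colLabel {k n : ℕ} {T : Set (Edge n)}
    (hT : IsKTriangulation k T) {c : Edge n} (hc : c ∉ T) :
    rowLabel (upperCells T) c.lo c.hi < colLabel (upperCells T) c.lo c.hi := by
  classical
  induction hm : (c.lo + c.hi : ℕ) using Nat.strong_induction_on generalizing c with
  | _ m ih =>
  by_contra hle
  have hnot : ¬ IsCrossingFree (k + 1) (insert c T) := fun h =>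
    hc (hT.2 h (Set.subset_insert c T) (Set.mem_insert c T))
  simp only [IsCrossingFree, not_forall, not_not] at hnot
  obtain ⟨D, ⟨hcard, hD⟩, hDT⟩ := hnot
  have hcD : c ∈ D := by
    by_contra h
    refine hT.1 D ⟨hcard, hD⟩ fun e he => ?_
    rcases hDT he with rfl | h1
    · exact absurd he h
    · exact h1
  obtain ⟨q, hq, hsep⟩ := exists_separator ⟨c, hcD⟩ hD
  -- the part of `D` before `c`, and `c` itself, are replaced by a set `C` in `T`
  set NW := D.filter fun e => e.lo < c.lo with hNW
  set SE := D.filter fun e => c.lo < e.lo with hSE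
  have hmemT : ∀ e ∈ D, e ≠ c → e ∈ T := fun e he hne => (hDT he).resolve_left hne
  have hDcard : D.card ≤ NW.card + 1 + SE.card := by
    have : D ⊆ (NW ∪ {c}) ∪ SE := by
      intro e he
      by_cases h : e = c
      · simp [h]
      · have := hD e he c hcD h
        simp only [hNW, hSE, Finset.mem_union, Finset.mem_filter, he, true_and]
        rcases this with h1 | h1 <;> unfold Edge.CrossLeft at h1 <;> omega
    refine (Finset.card_le_card this).trans ((Finset.card_union_le _ _).trans ?_)
    gcongr
    exact Finset.card_union_le _ _
  have hNWcard : NW.card ≤ labelCount (upperCells T) q c.lo c.hi := by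
    refine card_le_labelCount (hsep c hcD).1.le (hsep c hcD).2 c.hi.2.le
      (fun e he f hf => hD e (Finset.mem_filter.1 he).1 f (Finset.mem_filter.1 hf).1)
      (fun e he => ?_) (fun e he => ?_)
    · have h1 := Finset.mem_filter.1 he
      exact hmemT e h1.1 (by rintro rfl; exact lt_irrefl _ h1.2)
    · have h1 := Finset.mem_filter.1 he
      have h2 := hD e h1.1 c hcD (by rintro rfl; exact lt_irrefl _ h1.2)
      have h3 := hsep e h1.1
      rcases h2 with h2 | h2 <;> unfold Edge.CrossLeft at h2 <;> omega
  obtain ⟨C, hC, hCT, hreg, hCcard⟩ : ∃ C : Finset (Edge n),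
      (∀ e ∈ C, ∀ f ∈ C, e ≠ f → e.Cross f) ∧ (C : Set (Edge n)) ⊆ T ∧
      (∀ e ∈ C, e.lo ≤ c.lo ∧ q ≤ e.hi ∧ e.hi ≤ c.hi) ∧
      C.card = labelCount (upperCells T) q c.lo c.hi + 1 := by
    have hlo := (hsep c hcD).1
    have hhi := (hsep c hcD).2
    -- as the labels at `c` are not in increasing order, going to the right or down by one cell
    -- already increases the number of labels
    by_cases h : q < rowLabel (upperCells T) c.lo c.hi
    · have h1 := labelCount_succ_left (upperCells T) q c.lo c.hi
      rw [if_pos h] at h1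
      rw [← h1]
      obtain ⟨C, h1, h2, h3, h4⟩ := exists_card_eq_labelCount (T := T) (q := q) (i := c.lo + 1)
        (j := c.hi) hlo hhi c.hi.2.le
        (fun e he he' heT => ih (e.lo + e.hi) (by omega) heT rfl)
      exact ⟨C, h1, h2, fun e he => by have := h3 e he; omega, h4⟩
    · have h1 := labelCount_succ_right (upperCells T) (q := q) (i := c.lo) c.lo.2.le (j := c.hi) hhi
      rw [if_neg (by omega), Nat.add_zero] at h1
      rw [← h1]
      obtain ⟨C, h1, h2, h3, h4⟩ := exists_card_eq_labelCount (T := T) (q := q) (i := c.lo)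
        (j := c.hi + 1) hlo.le (by omega) c.hi.2
        (fun e he he' heT => ih (e.lo + e.hi) (by omega) heT rfl)
      exact ⟨C, h1, h2, fun e he => by have := h3 e he; omega, h4⟩
  have hSEc : ∀ f ∈ SE, c.lo < f.lo ∧ (f.lo : ℕ) < q ∧ c.hi < f.hi := by
    intro f hf
    have h1 := Finset.mem_filter.1 hf
    have h2 := hD f h1.1 c hcD (by rintro rfl; exact lt_irrefl _ h1.2)
    have h3 := hsep f h1.1
    rcases h2 with h2 | h2 <;> unfold Edge.CrossLeft at h2 <;> omega
  have hcross : ∀ e ∈ C, ∀ f ∈ SE, e.CrossLeft f := by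
    intro e he f hf
    have h1 := hreg e he
    have h2 := hSEc f hf
    unfold Edge.CrossLeft
    omega
  have hdisj : Disjoint C SE := by
    rw [Finset.disjoint_left]
    intro e he he'
    exact lt_irrefl _ (hcross e he e he').1
  have hfinal := hT.1.card_le (C := C ∪ SE) (fun e he f hf hef => by
      rcases Finset.mem_union.1 he with he | he <;> rcases Finset.mem_union.1 hf with hf | hf
      · exact hC e he f hf hef
      · exact Or.inl (hcross e he f hf)
      · exact Or.inr (hcross f hf e he)
      · exact hD e (Finset.mem_filter.1 he).1 f (Finset.mem_filter.1 hf).1 hef)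
    (fun e he => by
      rcases Finset.mem_union.1 he with he | he
      · exact hCT he
      · have h1 := Finset.mem_filter.1 he
        exact hmemT e h1.1 (by rintro rfl; exact lt_irrefl _ h1.2))
  rw [Finset.card_union_of_disjoint hdisj] at hfinal
  omega

theorem IsKTriangulation.labelCount_le {k n : ℕ} {T : Set (Edge n)} (hT : IsKTriangulation k T)
    {q : ℕ} (hq : q ≤ n) : labelCount (upperCells T) q q n ≤ k := by
  obtain ⟨C, h1, h2, -, h4⟩ := exists_card_eq_labelCount (T := T) le_rfl hq le_rfl
    fun e _ _ he => hT.rowLabel_lt_colLabel he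
  rw [← h4]
  exact hT.1.card_le h1 h2

/-! ### The permutation of a `k`-triangulation -/

/-- The permutation of the labels of the columns that is read off the rows at the end. -/
theorem exists_perm_pipes {n : ℕ} (T : Set (Edge n)) : ∃ x : Equiv.Perm (Fin n),
    ∀ i, pipes (upperCells T) (n * n) (Sum.inl i) = Sum.inr (x i) := by
  have h : ∀ i, ∃ j, pipes (upperCells T) (n * n) (Sum.inl i) = Sum.inr j := by
    intro i
    have h1 := rowLabel_pos T (i := i) le_rfl i.2
    rw [rowLabel_top] at h1
    rcases h2 : pipes (upperCells T) (n * n) (Sum.inl i) with a | b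
    · rw [h2] at h1
      exact absurd h1 (lt_irrefl _)
    · exact ⟨b, rfl⟩
  choose x hx using h
  have hinj : Function.Injective x := fun a b hab =>
    Sum.inl_injective ((pipes (upperCells T) (n * n)).injective (by rw [hx, hx, hab]))
  exact ⟨Equiv.ofBijective x (Finite.injective_iff_bijective.1 hinj), hx⟩

theorem labelCount_top {n : ℕ} {T : Set (Edge n)} {x : Equiv.Perm (Fin n)}
    (hx : ∀ i, pipes (upperCells T) (n * n) (Sum.inl i) = Sum.inr (x i)) (q : ℕ) :
    labelCount (upperCells T) q q n =
      (Finset.univ.filter fun a : Fin n => (a : ℕ) < q ∧ q ≤ x a).card := by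
  rw [labelCount]
  congr 1
  ext a
  rw [Finset.mem_filter, Finset.mem_filter, rowLabel_top, hx, columnNumber, Nat.lt_succ_iff]

/-- Two labels can only exchange their order along the staircase in a cell outside of `T`, by going
straight through it. -/
theorem exists_cell_of_before {n : ℕ} (T : Set (Fin n × Fin n)) {r s : ℕ} (hrs : r ≤ s)
    (hs : s ≤ n * n) {u w : Fin n ⊕ Fin n}
    (h0 : Before r ((pipes T r)⁻¹ u) ((pipes T r)⁻¹ w))
    (h1 : Before s ((pipes T s)⁻¹ w) ((pipes T s)⁻¹ u)) :
    ∃ c ∉ T, pipes T (cellIndex c) (Sum.inl c.1) = w ∧ pipes T (cellIndex c) (Sum.inr c.2) = u := by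
  induction s, hrs using Nat.le_induction with
  | base => exact absurd h1 h0.asymm
  | succ s hrs ih =>
    by_cases h2 : Before s ((pipes T s)⁻¹ w) ((pipes T s)⁻¹ u)
    · exact ih (by omega) h2
    obtain ⟨c, rfl⟩ := exists_cellIndex_eq (n := n) (r := s) (by omega)
    by_cases hc : c ∈ T
    · rw [before_succ_iff, pipes_succ_of_mem hc, mul_inv_rev, Equiv.swap_inv] at h1
      simp only [Equiv.Perm.mul_apply, Equiv.swap_apply_self] at h1
      exact absurd h1 h2
    · rw [pipes_succ_of_notMem hc] at h1
      have h3 := mt (before_succ_of_ne h1) h2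
      rw [not_not, Equiv.Perm.inv_eq_iff_eq, Equiv.Perm.inv_eq_iff_eq] at h3
      exact ⟨c, hc, h3.1.symm, h3.2.symm⟩

theorem pipes_insert_of_le {n : ℕ} (T : Set (Fin n × Fin n)) {c : Fin n × Fin n} {r : ℕ}
    (hr : r ≤ cellIndex c) : pipes (insert c T) r = pipes T r := by
  induction r with
  | zero => rfl
  | succ r ih =>
    have hr' := cellIndex_lt c
    obtain ⟨d, rfl⟩ := exists_cellIndex_eq (n := n) (r := r) (by omega)
    have hdc : d ≠ c := by rintro rfl; omega
    by_cases hd : d ∈ T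
    · rw [pipes_succ_of_mem hd, pipes_succ_of_mem (Set.mem_insert_of_mem c hd), ih (by omega)]
    · rw [pipes_succ_of_notMem hd, pipes_succ_of_notMem (by simp [hdc, hd]), ih (by omega)]

/-- Adding the cell `c` to `T` exchanges the two labels that meet in it from there on. -/
theorem pipes_insert {n : ℕ} {T : Set (Fin n × Fin n)} {c : Fin n × Fin n} (hc : c ∉ T) {r : ℕ}
    (hr : cellIndex c + 1 ≤ r) (hrn : r ≤ n * n) : pipes (insert c T) r =
      Equiv.swap (pipes T (cellIndex c) (Sum.inl c.1)) (pipes T (cellIndex c) (Sum.inr c.2)) *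
        pipes T r := by
  induction r, hr using Nat.le_induction with
  | base =>
    rw [pipes_succ_of_mem (Set.mem_insert c T), pipes_succ_of_notMem hc,
      pipes_insert_of_le T le_rfl, Equiv.mul_swap_eq_swap_mul]
  | succ r hr ih =>
    obtain ⟨d, rfl⟩ := exists_cellIndex_eq (n := n) (r := r) (by omega)
    have hdc : d ≠ c := by rintro rfl; omega
    by_cases hd : d ∈ T
    · rw [pipes_succ_of_mem hd, pipes_succ_of_mem (Set.mem_insert_of_mem c hd), ih (by omega),
        mul_assoc]
    · rw [pipes_succ_of_notMem hd, pipes_succ_of_notMem (by simp [hdc, hd]), ih (by omega)]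

theorem upperCells_insert {n : ℕ} (T : Set (Edge n)) (e : Edge n) :
    upperCells (insert e T) = insert (e.lo, e.hi) (upperCells T) := by
  ext c
  by_cases hc : c.1 < c.2
  · simp [upperCells, hc, Subtype.ext_iff, Edge.lo, Edge.hi]
  · have : c ∈ upperCells T := fun h => absurd h hc
    simp only [this, Set.mem_insert_iff, or_true, iff_true]
    exact fun h => absurd h hc

/-- The two labels that leave a `k`-triangulation in the rows `a < b` in increasing order meet in a
cell outside of `T`. Adding this cell exchanges them and, as `T` is maximal, produces too large a
crossing, which shows in the number of labels. -/
theorem IsKTriangulation.exists_lt_card {k n : ℕ} {T : Set (Edge n)} (hT : IsKTriangulation k T)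
    {x : Equiv.Perm (Fin n)}
    (hx : ∀ i, pipes (upperCells T) (n * n) (Sum.inl i) = Sum.inr (x i)) {a b : Fin n}
    (hab : a < b) (hxab : x a < x b) : ∃ q ≤ n, k <
      (Finset.univ.filter fun i : Fin n => (i : ℕ) < q ∧ q ≤ (x * Equiv.swap a b) i).card := by
  have hinv : ∀ i, (pipes (upperCells T) (n * n))⁻¹ (Sum.inr (x i)) = Sum.inl i := fun i => by
    rw [Equiv.Perm.inv_eq_iff_eq, hx]
  obtain ⟨c, hc, h1, h2⟩ := exists_cell_of_before (upperCells T) (Nat.zero_le _) le_rfl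
    (u := Sum.inr (x b)) (w := Sum.inr (x a)) hxab (by rw [hinv, hinv]; exact hab)
  obtain ⟨e, he, rfl⟩ := exists_edge_of_notMem_upperCells hc
  by_contra! hle
  refine he (hT.2 (y := insert e T) (isCrossingFree_of_labelCount_le fun q hq => ?_)
    (Set.subset_insert e T) (Set.mem_insert e T))
  rw [labelCount_top (x := x * Equiv.swap a b) (fun i => ?_) q]
  · exact hle q hq
  · rw [upperCells_insert, pipes_insert hc (cellIndex_lt _) le_rfl, h1, h2,
      Equiv.Perm.mul_apply, hx, Equiv.Perm.mul_apply]
    simp only [Equiv.swap_apply_def, Sum.inr.injEq, EmbeddingLike.apply_eq_iff_eq]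
    split_ifs <;> rfl

/-- Distinct cells outside of a `k`-triangulation contain distinct pairs of labels, which are in
increasing order at the end. -/
theorem IsKTriangulation.ncard_compl_le {k n : ℕ} {T : Set (Edge n)} (hT : IsKTriangulation k T)
    {x : Equiv.Perm (Fin n)}
    (hx : ∀ i, pipes (upperCells T) (n * n) (Sum.inl i) = Sum.inr (x i)) :
    Tᶜ.ncard ≤ {p : Edge n | x p.lo < x p.hi}.ncard := by
  have hinv : ∀ i, (pipes (upperCells T) (n * n))⁻¹ (Sum.inr (x i)) = Sum.inl i := fun i => by
    rw [Equiv.Perm.inv_eq_iff_eq, hx]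
  -- two labels never meet in decreasing order, so that they meet at most once
  have hno : ∀ c ∉ upperCells T, ∀ y₁ y₂ : Fin n, y₁ < y₂ →
      pipes (upperCells T) (cellIndex c) (Sum.inl c.1) = Sum.inr y₂ →
      pipes (upperCells T) (cellIndex c) (Sum.inr c.2) = Sum.inr y₁ → False := by
    intro c hc y₁ y₂ hy h1 h2
    obtain ⟨e, he, rfl⟩ := exists_edge_of_notMem_upperCells hc
    have h3 := hT.rowLabel_lt_colLabel he
    rw [← rowLabel_cellIndex _ (e.lo, e.hi), ← colLabel_cellIndex _ (e.lo, e.hi), h1, h2] at h3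
    simp only [columnNumber] at h3
    omega
  have key : ∀ e : Edge n, e ∉ T → ∃ p : Edge n, x p.lo < x p.hi ∧
      pipes (upperCells T) (cellIndex (e.lo, e.hi)) (Sum.inl e.lo) = Sum.inr (x p.lo) ∧
      pipes (upperCells T) (cellIndex (e.lo, e.hi)) (Sum.inr e.hi) = Sum.inr (x p.hi) := by
    intro e he
    have he' := mt mem_upperCells_iff.1 he
    have h1 := rowLabel_pos T (i := e.lo) e.hi.2.le e.lo_lt_hi
    have h2 := hT.rowLabel_lt_colLabel he
    rw [← rowLabel_cellIndex _ (e.lo, e.hi)] at h1 h2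
    rw [← colLabel_cellIndex _ (e.lo, e.hi)] at h2
    simp only at h1 h2
    rcases h3 : pipes (upperCells T) (cellIndex (e.lo, e.hi)) (Sum.inl e.lo) with y | y₁
    · rw [h3] at h1
      exact absurd h1 (lt_irrefl _)
    rcases h4 : pipes (upperCells T) (cellIndex (e.lo, e.hi)) (Sum.inr e.hi) with y | y₂
    · rw [h4] at h2
      exact absurd h2 (Nat.not_lt_zero _)
    rw [h3, h4] at h2
    have hy : y₁ < y₂ := by
      simp only [columnNumber] at h2
      omega
    obtain ⟨a, rfl⟩ := x.surjective y₁
    obtain ⟨b, rfl⟩ := x.surjective y₂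
    have hab : a < b := by
      by_contra hab
      have hne : b ≠ a := by rintro rfl; exact lt_irrefl _ hy
      obtain ⟨c, hc, h5, h6⟩ := exists_cell_of_before (upperCells T)
        (r := cellIndex (e.lo, e.hi) + 1) (s := n * n) (cellIndex_lt _) le_rfl
        (u := Sum.inr (x a)) (w := Sum.inr (x b)) (by
          rw [pipes_succ_of_notMem he', ← h3, ← h4, Equiv.Perm.inv_def,
            Equiv.symm_apply_apply, Equiv.symm_apply_apply]
          exact Nat.lt_succ_self _) (by
          rw [hinv, hinv]
          exact lt_of_le_of_ne (not_lt.1 hab) hne)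
      exact hno c hc _ _ hy h5 h6
    exact ⟨⟨(a, b), hab⟩, hy, rfl, rfl⟩
  choose! p hp1 hp2 hp3 using key
  refine Set.ncard_le_ncard_of_injOn p (fun e he => hp1 e he) (fun e he f hf hef => ?_)
    (Set.toFinite _)
  have hmain : ∀ e ∉ T, ∀ f ∉ T, p e = p f →
      ¬ cellIndex (e.lo, e.hi) < cellIndex (f.lo, f.hi) := by
    intro e he f hf hef hlt
    have he' := mt mem_upperCells_iff.1 he
    obtain ⟨c, hc, h5, h6⟩ := exists_cell_of_before (upperCells T)
      (r := cellIndex (e.lo, e.hi) + 1) (s := cellIndex (f.lo, f.hi)) hlt (cellIndex_lt _).le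
      (u := Sum.inr (x (p e).lo)) (w := Sum.inr (x (p e).hi)) (by
        rw [pipes_succ_of_notMem he', ← hp2 e he, ← hp3 e he, Equiv.Perm.inv_def,
          Equiv.symm_apply_apply, Equiv.symm_apply_apply]
        exact Nat.lt_succ_self _) (by
        rw [hef, ← hp2 f hf, ← hp3 f hf, Equiv.Perm.inv_def,
          Equiv.symm_apply_apply, Equiv.symm_apply_apply]
        exact le_refl (cellIndex (f.lo, f.hi)))
    exact hno c hc _ _ (hp1 e he) h5 h6
  have h1 := cellIndex_injective (le_antisymm (not_lt.1 (hmain f hf e he hef.symm))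
    (not_lt.1 (hmain e he f hf hef)))
  exact Edge.ext (Prod.ext_iff.1 h1).1 (Prod.ext_iff.1 h1).2

/-- The permutation of a `k`-triangulation: it exchanges `i` and `n - 1 - i` for `i < k` and fixes
everything in between. -/
def triangulationPerm (k n i : ℕ) : ℕ := if i < k ∨ n - k ≤ i then n - 1 - i else i

theorem triangulationPerm_eq (k n i : ℕ) :
    ((i < k ∨ n - k ≤ i) ∧ triangulationPerm k n i = n - 1 - i) ∨
      ((k ≤ i ∧ i < n - k) ∧ triangulationPerm k n i = i) := by
  unfold triangulationPerm
  split_ifs <;> omega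

/-- At the first row where `x` differs from `triangulationPerm`, it takes a smaller value, which can
be exchanged with a later one without violating the bounds. -/
theorem perm_eq_triangulationPerm {k n : ℕ} (hn : 2 * k + 2 ≤ n) {x : Equiv.Perm (Fin n)}
    (h₁ : ∀ q ≤ n, (Finset.univ.filter fun i : Fin n => (i : ℕ) < q ∧ q ≤ x i).card ≤ k)
    (h₂ : ∀ a b, a < b → x a < x b → ∃ q ≤ n, k <
      (Finset.univ.filter fun i : Fin n => (i : ℕ) < q ∧ q ≤ (x * Equiv.swap a b) i).card)
    (a : Fin n) : (x a : ℕ) = triangulationPerm k n a := by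
  induction hm : (a : ℕ) using Nat.strong_induction_on generalizing a with
  | _ m ih =>
  subst hm
  have ih' : ∀ i : Fin n, (i : ℕ) < a → (x i : ℕ) = triangulationPerm k n i :=
    fun i hi => ih i hi i rfl
  -- no later row takes a value of `triangulationPerm` at an earlier row
  have hnew : ∀ i : ℕ, i < a → ∀ b : Fin n, a ≤ b → (x b : ℕ) ≠ triangulationPerm k n i := by
    intro i hi b hb h
    have h1 := ih' ⟨i, by omega⟩ hi
    rw [← h, ← Fin.ext_iff, EmbeddingLike.apply_eq_iff_eq, Fin.ext_iff] at h1
    simp only at h1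
    omega
  have hw := triangulationPerm_eq k n a
  have hle : (x a : ℕ) ≤ triangulationPerm k n a := by
    by_contra! hlt
    by_cases ha : (a : ℕ) < k ∨ n - k ≤ a
    · have h1 := triangulationPerm_eq k n (x a)
      have h2 := triangulationPerm_eq k n (triangulationPerm k n (x a))
      exact hnew (triangulationPerm k n (x a)) (by omega) a le_rfl (by omega)
    · have h1 := h₁ (a + 1) a.2
      have h2 : (insert a (Finset.univ.filter fun i : Fin n => (i : ℕ) < k)) ⊆
          Finset.univ.filter fun i : Fin n => (i : ℕ) < a + 1 ∧ a + 1 ≤ (x i : ℕ) := by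
        intro i hi
        rw [Finset.mem_insert, Finset.mem_filter] at hi
        rw [Finset.mem_filter]
        refine ⟨Finset.mem_univ _, ?_⟩
        rcases hi with rfl | ⟨-, hi⟩
        · omega
        · have h3 := ih' i (by omega)
          have h4 := triangulationPerm_eq k n i
          omega
      have h3 := Finset.card_le_card h2
      rw [Finset.card_insert_of_notMem (by simp; omega), Fin.card_filter_val_lt,
        min_eq_right (by omega)] at h3
      omega
  refine le_antisymm hle ?_
  by_contra! hlt
  have hwn : triangulationPerm k n a < n := by omega
  set B := Finset.univ.filter fun b : Fin n =>
    a < b ∧ x a < x b ∧ (x b : ℕ) ≤ triangulationPerm k n a with hB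
  have hBne : B.Nonempty := by
    obtain ⟨b, hb⟩ := x.surjective ⟨_, hwn⟩
    have hb' : (x b : ℕ) = triangulationPerm k n a := by rw [hb]
    refine ⟨b, Finset.mem_filter.2 ⟨Finset.mem_univ _, ?_, by rw [Fin.lt_def]; omega, hb'.le⟩⟩
    rcases lt_trichotomy a b with h | rfl | h
    · exact h
    · omega
    · have h1 := ih' b h
      have h2 := triangulationPerm_eq k n b
      omega
  obtain ⟨b, hbB, hmin⟩ := B.exists_min_image id hBne
  obtain ⟨-, hab, hxab, hxb⟩ := Finset.mem_filter.1 hbB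
  obtain ⟨q, hq, hcard⟩ := h₂ a b hab hxab
  refine absurd hcard (not_lt.2 ?_)
  have hswap : ∀ i : Fin n, i ≠ a → i ≠ b → (x * Equiv.swap a b) i = x i := fun i ha hb => by
    rw [Equiv.Perm.mul_apply, Equiv.swap_apply_of_ne_of_ne ha hb]
  have hswapa : (x * Equiv.swap a b) a = x b := by
    rw [Equiv.Perm.mul_apply, Equiv.swap_apply_left]
  -- the exchange only increases the number of rows `i < q` with values `≥ q` if `q` lies between
  -- `a` and `b` and between `x a` and `x b`; then all rows counted are at most `a`, and `a < k`
  by_cases hqb : (b : ℕ) < q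
  · refine (Finset.card_le_card_of_injOn (Equiv.swap a b) (fun i hi => ?_)
      (Equiv.swap a b).injective.injOn).trans (h₁ q hq)
    obtain ⟨-, h1, h2⟩ := Finset.mem_filter.1 hi
    refine Finset.mem_filter.2 ⟨Finset.mem_univ _, ?_, h2⟩
    rw [Equiv.swap_apply_def]
    split_ifs <;> omega
  by_cases hqa : (a : ℕ) < q ∧ (x a : ℕ) < q ∧ q ≤ x b
  · have ha : (a : ℕ) < k ∧ triangulationPerm k n a = n - 1 - a := by omega
    refine le_trans (Finset.card_le_card (t := Finset.Iic a) fun i hi => ?_) ?_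
    · obtain ⟨-, h1, h2⟩ := Finset.mem_filter.1 hi
      rw [Finset.mem_Iic]
      by_contra! hai
      rw [hswap i hai.ne' (by omega)] at h2
      have h3 : i ∉ B := fun h => by
        have := hmin i h
        simp only [id] at this
        omega
      rw [hB, Finset.mem_filter] at h3
      simp only [Finset.mem_univ, true_and, not_and, not_le] at h3
      have h4 := h3 hai (by omega)
      have h5 := triangulationPerm_eq k n (n - 1 - x i)
      exact hnew (n - 1 - x i) (by omega) i hai.le (by omega)
    · rw [Fin.card_Iic]
      omega
  · refine (Finset.card_le_card fun i hi => ?_).trans (h₁ q hq)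
    obtain ⟨-, h1, h2⟩ := Finset.mem_filter.1 hi
    refine Finset.mem_filter.2 ⟨Finset.mem_univ _, h1, ?_⟩
    by_cases hia : i = a
    · subst hia
      rw [hswapa] at h2
      omega
    · rwa [hswap i hia (by omega)] at h2

/-! ### Independence and cardinality of `k`-triangulations -/

theorem IsKTriangulation.exists_perm {k n : ℕ} (hn : 2 * k + 2 ≤ n) {T : Set (Edge n)}
    (hT : IsKTriangulation k T) : ∃ x : Equiv.Perm (Fin n),
      (∀ i, pipes (upperCells T) (n * n) (Sum.inl i) = Sum.inr (x i)) ∧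
        ∀ i, (x i : ℕ) = triangulationPerm k n i := by
  obtain ⟨x, hx⟩ := exists_perm_pipes T
  exact ⟨x, hx, perm_eq_triangulationPerm hn
    (fun q hq => labelCount_top hx q ▸ hT.labelCount_le hq)
    fun a b hab h => hT.exists_lt_card hx hab h⟩

theorem IsKTriangulation.indep (K : Type*) [Field K] {k n : ℕ} (hn : 2 * k + 2 ≤ n)
    {T : Set (Edge n)} (hT : IsKTriangulation k T) : (skewMatroid K k n).Indep T := by
  classical
  obtain ⟨x, hx, hxw⟩ := hT.exists_perm hn
  refine indep_skewMatroid_of_pipes K T ?_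
  -- only the first `k` rows end up with labels of columns above the diagonal
  have h : {j | ∃ i < j, pipes (upperCells T) (n * n) (Sum.inl i) = Sum.inr j} ⊆
      ((Finset.univ.filter fun i : Fin n => (i : ℕ) < k).image x : Finset (Fin n)) := by
    rintro j ⟨i, hij, h⟩
    rw [hx, Sum.inr.injEq] at h
    subst h
    have h1 := hxw i
    have h2 := triangulationPerm_eq k n i
    simp only [Finset.coe_image, Set.mem_image, Finset.mem_coe, Finset.mem_filter]
    exact ⟨i, ⟨Finset.mem_univ _, by omega⟩, rfl⟩
  refine (Set.ncard_le_ncard h (Finset.finite_toSet _)).trans ?_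
  rw [Set.ncard_coe_finset]
  refine Finset.card_image_le.trans ?_
  rw [Fin.card_filter_val_lt]
  exact min_le_right _ _

theorem IsKTriangulation.le_ncard {k n : ℕ} (hn : 2 * k + 2 ≤ n) {T : Set (Edge n)}
    (hT : IsKTriangulation k T) : 2 * n * k - (2 * k + 1).choose 2 ≤ T.ncard := by
  obtain ⟨x, hx, hxw⟩ := hT.exists_perm hn
  have h1 := hT.ncard_compl_le hx
  have h2 : {p : Edge n | x p.lo < x p.hi} ⊆
      (Finset.univ.filter fun e : Edge n => k ≤ (e.lo : ℕ) ∧ (e.hi : ℕ) < n - k : Finset _) := by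
    intro p hp
    have h3 := hxw p.lo
    have h4 := hxw p.hi
    have h5 := triangulationPerm_eq k n p.lo
    have h6 := triangulationPerm_eq k n p.hi
    have h7 := p.lo_lt_hi
    have h8 : x p.lo < x p.hi := hp
    rw [Finset.mem_coe, Finset.mem_filter]
    refine ⟨Finset.mem_univ _, ?_⟩
    omega
  have h3 := Set.ncard_le_ncard h2 (Finset.finite_toSet _)
  rw [Set.ncard_coe_finset, card_edges_between _ _ _ (Nat.sub_le n k), Nat.sub_sub, ← two_mul] at h3
  have h4 := Set.ncard_add_ncard_compl T
  rw [Nat.card_eq_fintype_card, card_edge] at h4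
  have h5 := choose_two_eq_add hn
  omega

theorem mainTheorem6 (K : Type*) [Field K] (k n : ℕ) (hn : 2 * k + 2 ≤ n) :
    ∃ M : Matroid (Edge n), IsAlgebraicMatroid (pfaffianIdeal K k n) M ∧
      (∀ T : Set (Edge n), IsCrossingFree (k + 1) T → M.Indep T) ∧
      (∀ T : Set (Edge n), IsKTriangulation k T → M.IsBase T) ∧
      M.eRank = ((2 * n * k - (2 * k + 1).choose 2 : ℕ) : ℕ∞) := by
  have hle : ∀ T : Set (Edge n), IsKTriangulation k T →
      ((2 * n * k - (2 * k + 1).choose 2 : ℕ) : ℕ∞) ≤ T.encard := fun T hT => by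
    rw [← (Set.toFinite T).cast_ncard_eq]
    exact_mod_cast hT.le_ncard hn
  have hmax : ∀ T : Set (Edge n), IsCrossingFree (k + 1) T →
      ∃ T', T ⊆ T' ∧ IsKTriangulation k T' := fun T hT =>
    (Set.toFinite {T : Set (Edge n) | IsCrossingFree (k + 1) T}).exists_le_maximal hT
  have hbase : ∀ T : Set (Edge n), IsKTriangulation k T → (skewMatroid K k n).IsBase T :=
    fun T hT => by
      have hind := hT.indep K hn
      refine hind.isBase_of_eRk_ge (Set.toFinite T) ?_
      rw [hind.eRk_eq_encard]
      exact (eRank_skewMatroid_le K hn).trans (hle T hT)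
  refine ⟨skewMatroid K k n, isAlgebraicMatroid_skewMatroid K k n, fun T hT => ?_, hbase,
    le_antisymm (eRank_skewMatroid_le K hn) ?_⟩
  · obtain ⟨T', hTT', hT'⟩ := hmax T hT
    exact (hT'.indep K hn).subset hTT'
  · obtain ⟨T', -, hT'⟩ := hmax ∅ fun C hC hCT => by
      have h := hC.1
      rw [Finset.coe_eq_empty.1 (Set.subset_empty_iff.1 hCT), Finset.card_empty] at h
      omega
    rw [← (hbase T' hT').encard_eq_eRank]
    exact hle T' hT'
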